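/- Let $n,p,m\ge 1$, let $x_1,\dots,x_n\in\mathbb R^p$ with $\|x_i\|_2=1$, and let $y_1,\dots,y_n\in\mathbb R$ with $|y_i|<B$. Consider the two-layer ReLU network $$f(W,a,x)=\frac1{\sqrt m}\sum_{r=1}^m a_r\,\sigma(w_r^\top x),\qquad \sigma(z)=\max\{z,0\},\quad W=(w_1,\dots,w_m)\in(\mathbb R^p)^m,\ a\in\mathbb R^m,$$ with the loss $L(W,a)=\frac12\sum_{i=1}^n (f(W,a,x_i)-y_i)^2$. Put $\Delta_i=f(W,a,x_i)-y_i$, let $H(W)\in\mathbb R^{n\times n}$ be the matrix $H_{ij}=\frac1m x_i^\top x_j\sum_{r=1}^m \mathbb 1\{w_r^\top x_i\ge 0,\ w_r^\top x_j\ge 0\}$, and let $\hat L=\frac12\Delta^\top H\Delta$. Let $$H^\infty_{ij}=\mathbb E_{w\sim N(0,I)}\big[x_i^\top x_j\,\mathbb 1\{w^\top x_i\ge0,\ w^\top x_j\ge 0\}\big],\qquad \lambda_0=\lambda_{\min}(H^\infty),$$ and assume $\lambda_0>0$. For every $B$ there is a constant $C>0$, depending only on $B$, such that the following holds for all such data and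 all $\delta\in(0,1)$. Suppose that $m\ge C\,\dfrac{n^6}{\delta^3\lambda_0^4}$ and that all $w_r(0)\sim N(0,I)$ and $a_r\sim\mathrm{unif}\{-1,1\}$, $r=1,\dots,m$, are drawn independently. Then, with probability at least $1-\delta$ over the initialization, every solution $W(t)=(w_r(t))_r$, $t\ge 0$, of the Heavy Ball system ($a$ is kept fixed) $$\ddot w_r(t)+\sqrt{2\lambda_0}\,\dot w_r(t)+\frac{\partial L(W(t),a)}{\partial w_r}=0,\qquad \dot w_r(0)=0,\qquad r=1,\dots,m,$$ with this initial value satisfies, for all $t\ge 0$, $$L(t)\le \frac4{\lambda_0}\,\exp\!\big(-\sqrt{\lambda_0/2}\;t\big)\,\hat L(0),$$ where $L(t)=L(W(t),a)$ and $\hat L(0)$ is the value of $\hat L$ at the initialization $(W(0),a)$. Here $\frac{\partial L}{\partial w_r}=\sum_i (f(W,a,x_i)-y_i)\frac{a_r}{\sqrt m}\,\sigma'(w_r^\top x_i)\,x_i$ and, since this is discontinuous in $W$, a solution means: $W$ is differentiable on $[0,\infty)$, $\dot W$ is absolutely continuous on bounded intervals, and the equation holds for almost every $t\ge0$, where $\sigma'(0)$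 may be any value in $[0,1]$ (possibly depending on $t$, $r$ and $i$). -/

import Mathlib

open MeasureTheory ProbabilityTheory

noncomputable section

namespace HeavyBallNTK

/-- The ReLU activation. -/
def relu (z : ℝ) : ℝ := max z 0

/-- The (convex) subdifferential of the ReLU: `{1}` for `z > 0`, `{0}` for `z < 0`, and `[0, 1]`
at the kink `z = 0`. It contains both `𝟙(z ≥ 0)` and `𝟙(z > 0)`. -/
def reluSubdiff (z : ℝ) : Set ℝ :=
  {s | 0 ≤ s ∧ s ≤ 1 ∧ (0 < z → s = 1) ∧ (z < 0 → s = 0)}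

/-- The two-layer network `f(W, a, x) = m^{-1/2} ∑ᵣ aᵣ σ(wᵣᵀ x)`. -/
def network {m p : ℕ} (W : Fin m → EuclideanSpace ℝ (Fin p)) (a : Fin m → ℝ)
    (x : EuclideanSpace ℝ (Fin p)) : ℝ :=
  1 / Real.sqrt m * ∑ r, a r * relu (inner ℝ (W r) x)

/-- The prediction error `Δ = f - y ∈ ℝⁿ` on the training set `(xᵢ, yᵢ)`. -/
def predError {m n p : ℕ} (x : Fin n → EuclideanSpace ℝ (Fin p)) (y : Fin n → ℝ)
    (W : Fin m → EuclideanSpace ℝ (Fin p)) (a : Fin m → ℝ) : Fin n → ℝ :=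
  fun i => network W a (x i) - y i

/-- The loss `L = 1/2 ∑ᵢ (f(W, a, xᵢ) - yᵢ)²`. -/
def loss {m n p : ℕ} (x : Fin n → EuclideanSpace ℝ (Fin p)) (y : Fin n → ℝ)
    (W : Fin m → EuclideanSpace ℝ (Fin p)) (a : Fin m → ℝ) : ℝ :=
  1 / 2 * ∑ i, (network W a (x i) - y i) ^ 2

open Classical in
/-- The finite-width kernel `H_{ij} = m⁻¹ xᵢᵀxⱼ ∑ᵣ 𝟙(wᵣᵀxᵢ ≥ 0, wᵣᵀxⱼ ≥ 0)`. -/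
def ntkMatrix {m n p : ℕ} (x : Fin n → EuclideanSpace ℝ (Fin p))
    (W : Fin m → EuclideanSpace ℝ (Fin p)) : Matrix (Fin n) (Fin n) ℝ :=
  Matrix.of fun i j => 1 / (m : ℝ) * inner ℝ (x i) (x j) *
    ∑ r, if 0 ≤ inner ℝ (W r) (x i) ∧ 0 ≤ inner ℝ (W r) (x j) then (1 : ℝ) else 0

/-- The pseudo-loss `L̂ = 1/2 Δᵀ H Δ`. -/
def pseudoLoss {m n p : ℕ} (x : Fin n → EuclideanSpace ℝ (Fin p)) (y : Fin n → ℝ)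
    (W : Fin m → EuclideanSpace ℝ (Fin p)) (a : Fin m → ℝ) : ℝ :=
  1 / 2 * (predError x y W a ⬝ᵥ (ntkMatrix x W).mulVec (predError x y W a))

open Classical in
/-- The limiting kernel `H^∞_{ij} = 𝔼_{w ∼ N(0, I)} [xᵢᵀxⱼ 𝟙(wᵀxᵢ ≥ 0, wᵀxⱼ ≥ 0)]`. -/
def limitNTK {n p : ℕ} (x : Fin n → EuclideanSpace ℝ (Fin p)) : Matrix (Fin n) (Fin n) ℝ :=
  Matrix.of fun i j => ∫ w, inner ℝ (x i) (x j) *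
    (if 0 ≤ inner ℝ w (x i) ∧ 0 ≤ inner ℝ w (x j) then (1 : ℝ) else 0)
      ∂(stdGaussian (EuclideanSpace ℝ (Fin p)))

/-- The smallest (real) eigenvalue of a square matrix. For a symmetric matrix of positive size the
set of eigenvalues is finite and non-empty, so the infimum is a minimum. -/
def lambdaMin {n : ℕ} (A : Matrix (Fin n) (Fin n) ℝ) : ℝ :=
  sInf {μ : ℝ | Module.End.HasEigenvalue (Matrix.toLin' A) μ}

/-- The uniform distribution on `{-1, 1}`. -/
def signMeasure : Measure ℝ :=
  (2⁻¹ : ENNReal) • Measure.dirac (-1) + (2⁻¹ : ENNReal) • Measure.dirac 1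

/-- The law of the initialization `(W, a)`: all `wᵣ ∼ N(0, I)` and `aᵣ ∼ unif{-1, 1}` are
independent. -/
def initLaw (m p : ℕ) : Measure ((Fin m → EuclideanSpace ℝ (Fin p)) × (Fin m → ℝ)) :=
  (Measure.pi fun _ : Fin m => stdGaussian (EuclideanSpace ℝ (Fin p))).prod
    (Measure.pi fun _ : Fin m => signMeasure)

/-- `∂L/∂wᵣ = ∑ᵢ (fᵢ - yᵢ) m^{-1/2} aᵣ s_{ri} xᵢ`, where `s_{ri}` is the value used for
`σ'(wᵣᵀxᵢ)`. -/
def lossGrad {m n p : ℕ} (x : Fin n → EuclideanSpace ℝ (Fin p)) (y : Fin n → ℝ)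
    (W : Fin m → EuclideanSpace ℝ (Fin p)) (a : Fin m → ℝ) (s : Fin m → Fin n → ℝ)
    (r : Fin m) : EuclideanSpace ℝ (Fin p) :=
  ∑ i, (predError x y W a i * (1 / Real.sqrt m * a r * s r i)) • x i

/-- Where the loss is differentiable in `wᵣ` because no `wᵣᵀxᵢ` vanishes, `lossGrad` is its
gradient in `wᵣ`. -/
theorem hasGradientAt_loss {m n p : ℕ} (x : Fin n → EuclideanSpace ℝ (Fin p)) (y : Fin n → ℝ)
    (W : Fin m → EuclideanSpace ℝ (Fin p)) (a : Fin m → ℝ) (s : Fin m → Fin n → ℝ) (r : Fin m)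
    (hW : ∀ i, inner ℝ (W r) (x i) ≠ 0)
    (hs : ∀ i, s r i ∈ reluSubdiff (inner ℝ (W r) (x i))) :
    HasGradientAt (fun u => loss x y (Function.update W r u) a) (lossGrad x y W a s r) (W r) := by
  have hrelu : ∀ i, HasDerivAt relu (s r i) (inner ℝ (W r) (x i)) := by
    intro i
    obtain ⟨-, -, h1, h0⟩ := hs i
    rcases lt_or_gt_of_ne (hW i) with h | h
    · rw [h0 h]
      refine (hasDerivAt_const _ (0 : ℝ)).congr_of_eventuallyEq ?_
      filter_upwards [eventually_lt_nhds h] with z hz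
      exact max_eq_right hz.le
    · rw [h1 h]
      refine (hasDerivAt_id _).congr_of_eventuallyEq ?_
      filter_upwards [eventually_gt_nhds h] with z hz
      exact max_eq_left hz.le
  have hnet : ∀ i, HasGradientAt (fun u => network (Function.update W r u) a (x i))
      ((1 / Real.sqrt m * a r * s r i) • x i) (W r) := by
    intro i
    have hin : HasFDerivAt (fun u : EuclideanSpace ℝ (Fin p) => inner ℝ u (x i))
        (innerSL ℝ (x i)) (W r) :=
      (innerSL ℝ (x i)).hasFDerivAt.congr_of_eventuallyEq
        (Filter.Eventually.of_forall fun u => by simp [real_inner_comm])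
    have h : HasFDerivAt (fun u : EuclideanSpace ℝ (Fin p) => relu (inner ℝ u (x i)))
        (s r i • innerSL ℝ (x i)) (W r) :=
      HasDerivAt.comp_hasFDerivAt (h₂ := relu) (W r) (hrelu i) hin
    have h2 := ((h.const_mul (a r)).add_const
      (∑ q ∈ Finset.univ.erase r, a q * relu (inner ℝ (W q) (x i)))).const_mul (1 / Real.sqrt m)
    rw [hasGradientAt_iff_hasFDerivAt]
    refine (h2.congr_fderiv ?_).congr_of_eventuallyEq (Filter.Eventually.of_forall fun u => ?_)
    · ext v
      simp [mul_assoc]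
    · change network (Function.update W r u) a (x i) = _
      rw [network, ← Finset.add_sum_erase _ _ (Finset.mem_univ r), Function.update_self]
      congr 2
      refine Finset.sum_congr rfl fun q hq => ?_
      rw [Function.update_of_ne (Finset.ne_of_mem_erase hq)]
  have hL := (HasFDerivAt.fun_sum (u := Finset.univ) fun i _ =>
    (((hnet i).hasFDerivAt.sub_const (y i)).pow 2)).const_mul (1 / 2 : ℝ)
  rw [hasGradientAt_iff_hasFDerivAt]
  refine hL.congr_fderiv ?_
  ext v
  simp [lossGrad, predError, Finset.mul_sum, mul_assoc]

/-- `W : [0, ∞) → ℝ^{m × p}` solves the Heavy Ball system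
`ẅᵣ + b ẇᵣ + ∂L(W, a)/∂wᵣ = 0`, `ẇᵣ(0) = 0`, for `r = 1, …, m`.
The right-hand side jumps where some `wᵣᵀxᵢ` changes sign, so the equation is understood in the
usual sense for such systems: `W` is differentiable with a locally absolutely continuous
derivative `V`, and the second order equation holds for almost every time, the derivative of the
ReLU at its kink being any of its subgradients. -/
def IsHeavyBallFlow {m n p : ℕ} (b : ℝ) (x : Fin n → EuclideanSpace ℝ (Fin p)) (y : Fin n → ℝ)
    (a : Fin m → ℝ) (W : ℝ → Fin m → EuclideanSpace ℝ (Fin p)) : Prop :=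
  ∃ V : ℝ → Fin m → EuclideanSpace ℝ (Fin p),
    (∀ t, 0 ≤ t → ∀ r, HasDerivWithinAt (fun τ => W τ r) (V t r) (Set.Ici 0) t) ∧
    (∀ r, V 0 r = 0) ∧
    (∀ T, 0 ≤ T → ∀ r, AbsolutelyContinuousOnInterval (fun τ => V τ r) 0 T) ∧
    ∀ᵐ t ∂(volume.restrict (Set.Ici (0 : ℝ))), ∃ s : Fin m → Fin n → ℝ,
      (∀ r i, s r i ∈ reluSubdiff (inner ℝ (W t r) (x i))) ∧
      ∀ r, ∃ A : EuclideanSpace ℝ (Fin p), HasDerivAt (fun τ => V τ r) A t ∧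
        A + b • V t r + lossGrad x y (W t) a s r = 0

end HeavyBallNTK

end

/-!
Let `Δ` be the prediction error and `V` the velocity of the weights. Along a Heavy Ball flow with
friction `2ρ`, where `ρ = √(λ₀ / 2)`, one has `Δ' = J V` and `V' = -2ρ V - J† Δ`, where `J` is the
Jacobian of the network and `J J†` is the kernel `H`. As long as the weights stay close to their
initial values, few activations have flipped and `J` is close to the initial Jacobian `A`. With
`M = A† (A A†)⁻¹`, the energy `½‖Δ‖² + ½‖V‖² + ρ⟨M Δ, V⟩` then decays like `exp (-ρ t)`: since
`A M = 1` and `M A` is an orthogonal projection, its dissipation is that of a heavy ball in a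
quadratic potential, and the error made in replacing `J` by `A` is absorbed because `H(0)` is close
to `H^∞`, which bounds `M`. Starting from rest, `ρ‖M‖ ≤ 3/4` makes the energy comparable to `‖Δ‖²`.

Each neuron is a damped particle driven by a force of size at most `√(n / m) ‖Δ‖`, so decay of `Δ`
confines it to a ball of radius of order `√(n / m) ‖Δ(0)‖ / ρ²`, and a continuity argument closes
the loop. The conditions on the initialization (`Δ(0)` is not large, few preactivations are near the
kink, `H(0)` is near `H^∞`) each follow from Markov's inequality. As the confinement radius only has
to be small compared with `λ₀ δ / n`, a width of order `n⁴` is enough.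
-/

namespace HeavyBallNTK

section AbsolutelyContinuous

open Set Filter

variable {a b : ℝ}

theorem absolutelyContinuousOnInterval_lipschitzWith_comp {X Y : Type*} [PseudoMetricSpace X]
    [PseudoMetricSpace Y] {K : NNReal} {φ : X → Y} {f : ℝ → X} (hφ : LipschitzWith K φ)
    (hf : AbsolutelyContinuousOnInterval f a b) :
    AbsolutelyContinuousOnInterval (fun t => φ (f t)) a b := by
  refine squeeze_zero (fun _ => Finset.sum_nonneg fun _ _ => dist_nonneg) (fun _ => ?_)
    (by simpa using Tendsto.const_mul (K : ℝ) hf)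
  rw [Finset.mul_sum]
  exact Finset.sum_le_sum fun _ _ => hφ.dist_le_mul _ _

theorem absolutelyContinuousOnInterval_const {X : Type*} [PseudoMetricSpace X] (c : X) (a b : ℝ) :
    AbsolutelyContinuousOnInterval (fun _ : ℝ => c) a b :=
  (LipschitzWith.const c).lipschitzOnWith.absolutelyContinuousOnInterval

theorem absolutelyContinuousOnInterval_finset_sum {F ι : Type*} [SeminormedAddCommGroup F]
    {f : ι → ℝ → F} (s : Finset ι) (hf : ∀ i ∈ s, AbsolutelyContinuousOnInterval (f i) a b) :
    AbsolutelyContinuousOnInterval (fun t => ∑ i ∈ s, f i t) a b := by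
  classical
  induction s using Finset.induction_on with
  | empty => simpa using absolutelyContinuousOnInterval_const (0 : F) a b
  | insert i s hi ih =>
    simp only [Finset.sum_insert hi]
    exact (hf i (by simp)).fun_add (ih fun j hj => hf j (by simp [hj]))

theorem absolutelyContinuousOnInterval_pi {ι : Type*} [Fintype ι] {X : ι → Type*}
    [∀ i, PseudoMetricSpace (X i)] {f : ℝ → ∀ i, X i}
    (hf : ∀ i, AbsolutelyContinuousOnInterval (fun t => f t i) a b) :
    AbsolutelyContinuousOnInterval f a b := by
  refine squeeze_zero (fun _ => Finset.sum_nonneg fun _ _ => dist_nonneg) (fun t => ?_)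
    (by simpa using tendsto_finsetSum Finset.univ fun i _ => hf i)
  rw [Finset.sum_comm]
  refine Finset.sum_le_sum fun k _ =>
    (dist_pi_le_iff (Finset.sum_nonneg fun _ _ => dist_nonneg)).2 fun i => ?_
  exact Finset.single_le_sum (f := fun i => dist (f (t.2 k).1 i) (f (t.2 k).2 i))
    (fun _ _ => dist_nonneg) (Finset.mem_univ i)

theorem absolutelyContinuousOnInterval_toLp {ι : Type*} [Fintype ι] {X : ι → Type*}
    [∀ i, NormedAddCommGroup (X i)] {f : ℝ → ∀ i, X i}
    (hf : ∀ i, AbsolutelyContinuousOnInterval (fun t => f t i) a b) :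
    AbsolutelyContinuousOnInterval (fun t => (WithLp.toLp 2 (f t) : PiLp 2 X)) a b :=
  absolutelyContinuousOnInterval_lipschitzWith_comp (PiLp.lipschitzWith_toLp 2 X)
    (absolutelyContinuousOnInterval_pi hf)

theorem absolutelyContinuousOnInterval_inner {U : Type*} [NormedAddCommGroup U]
    [InnerProductSpace ℝ U] {f g : ℝ → U} (hf : AbsolutelyContinuousOnInterval f a b)
    (hg : AbsolutelyContinuousOnInterval g a b) :
    AbsolutelyContinuousOnInterval (fun t => inner ℝ (f t) (g t)) a b := by
  have norm_mul_self {u : ℝ → U} (hu : AbsolutelyContinuousOnInterval u a b) :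
      AbsolutelyContinuousOnInterval (fun t => ‖u t‖ * ‖u t‖) a b :=
    have := absolutelyContinuousOnInterval_lipschitzWith_comp lipschitzWith_one_norm hu
    this.fun_mul this
  simp only [real_inner_eq_norm_add_mul_self_sub_norm_mul_self_sub_norm_mul_self_div_two,
    div_eq_inv_mul]
  exact (((norm_mul_self (hf.fun_add hg)).fun_sub (norm_mul_self hf)).fun_sub
    (norm_mul_self hg)).const_mul _

theorem absolutelyContinuousOnInterval_of_hasDerivWithinAt {E : Type*} [NormedAddCommGroup E]
    [NormedSpace ℝ E] {w v : ℝ → E} (hw : ∀ t ∈ uIcc a b, HasDerivWithinAt w (v t) (uIcc a b) t)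
    (hv : AbsolutelyContinuousOnInterval v a b) : AbsolutelyContinuousOnInterval w a b := by
  obtain ⟨C, hC⟩ := hv.exists_bound
  refine LipschitzOnWith.absolutelyContinuousOnInterval (K := C.toNNReal) ?_
  refine (convex_uIcc a b).lipschitzOnWith_of_nnnorm_hasDerivWithin_le hw fun t ht => ?_
  rw [← NNReal.coe_le_coe, coe_nnnorm]
  exact (hC t ht).trans (Real.le_coe_toNNReal C)

theorem antitoneOn_of_ae_deriv_nonpos {g : ℝ → ℝ} (hg : AbsolutelyContinuousOnInterval g a b)
    (hg' : ∀ᵐ s, s ∈ Ioo a b → deriv g s ≤ 0) : AntitoneOn g (Icc a b) := by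
  intro s hs t ht hst
  have hsub : uIcc s t ⊆ uIcc a b := by
    rw [uIcc_of_le hst, uIcc_of_le (hs.1.trans hs.2)]
    exact Icc_subset_Icc hs.1 ht.2
  have hint : ∫ u in s..t, deriv g u ≤ 0 := by
    rw [intervalIntegral.integral_of_le hst, integral_Ioc_eq_integral_Ioo]
    refine setIntegral_nonpos_ae measurableSet_Ioo ?_
    filter_upwards [hg'] with u hu hust
    exact hu ⟨hs.1.trans_lt hust.1, hust.2.trans_le ht.2⟩
  linarith [(hg.mono hsub).integral_deriv_eq_sub]

theorem le_exp_mul_of_ae_deriv_le_neg_mul {Φ : ℝ → ℝ} {ρ : ℝ}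
    (hΦ : AbsolutelyContinuousOnInterval Φ a b)
    (hΦ' : ∀ᵐ s, s ∈ Ioo a b → deriv Φ s ≤ -(ρ * Φ s)) {t : ℝ} (ht : t ∈ Icc a b) :
    Φ t ≤ Real.exp (-(ρ * (t - a))) * Φ a := by
  have hexp : AbsolutelyContinuousOnInterval (fun s => Real.exp (ρ * (s - a))) a b :=
    ContDiffOn.absolutelyContinuousOnInterval (by fun_prop)
  have hab : a ≤ b := ht.1.trans ht.2
  have hanti : AntitoneOn (fun s => Real.exp (ρ * (s - a)) * Φ s) (Icc a b) := by
    refine antitoneOn_of_ae_deriv_nonpos (hexp.fun_mul hΦ) ?_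
    filter_upwards [hΦ', hΦ.ae_differentiableAt] with s hle hdiff hs
    have hmem : s ∈ uIcc a b := by rw [uIcc_of_le hab]; exact Ioo_subset_Icc_self hs
    have hderiv := ((((hasDerivAt_id' s).sub_const a).const_mul ρ).exp).fun_mul
      (hdiff hmem).hasDerivAt
    have := mul_le_mul_of_nonneg_left (hle hs) (Real.exp_pos (ρ * (s - a))).le
    rw [hderiv.deriv]
    linarith
  have hle := hanti (left_mem_Icc.2 hab) ht ht.1
  simp only [sub_self, mul_zero, Real.exp_zero, one_mul] at hle
  rwa [Real.exp_neg, ← div_eq_inv_mul, le_div_iff₀' (Real.exp_pos _)]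

theorem norm_sub_le_sub_of_ae_norm_deriv_le {E : Type*} [NormedAddCommGroup E] [NormedSpace ℝ E]
    {f : ℝ → E} {h : ℝ → ℝ} (hf : AbsolutelyContinuousOnInterval f a b)
    (hh : AbsolutelyContinuousOnInterval h a b)
    (hfh : ∀ᵐ s, s ∈ Ioo a b → ∃ f', HasDerivAt f f' s ∧ ‖f'‖ ≤ deriv h s) {t : ℝ}
    (ht : t ∈ Icc a b) : ‖f t - f a‖ ≤ h t - h a := by
  obtain ⟨ℓ, hℓ, hℓf⟩ := exists_dual_vector'' ℝ (f t - f a)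
  have hab : a ≤ b := ht.1.trans ht.2
  have hanti : AntitoneOn (fun s => ℓ (f s) - h s) (Icc a b) := by
    refine antitoneOn_of_ae_deriv_nonpos
      ((absolutelyContinuousOnInterval_lipschitzWith_comp ℓ.lipschitz hf).fun_sub hh) ?_
    filter_upwards [hfh, hh.ae_differentiableAt] with s hle hdiff hs
    have hmem : s ∈ uIcc a b := by rw [uIcc_of_le hab]; exact Ioo_subset_Icc_self hs
    obtain ⟨f', hf', hnorm⟩ := hle hs
    have hderiv : HasDerivAt (fun s => ℓ (f s) - h s) (ℓ f' - deriv h s) s :=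
      (ℓ.hasFDerivAt.comp_hasDerivAt s hf').sub (hdiff hmem).hasDerivAt
    rw [hderiv.deriv]
    have := (le_abs_self (ℓ f')).trans (ℓ.le_of_opNorm_le hℓ f')
    linarith
  have hle := hanti (left_mem_Icc.2 hab) ht ht.1
  simp only [map_sub, RCLike.ofReal_real_eq_id, id_eq] at hℓf hle
  linarith

end AbsolutelyContinuous

section DampedMotion

open Set

variable {E : Type*} [NormedAddCommGroup E] [NormedSpace ℝ E] {v w : ℝ → E} {μ ν K T : ℝ}

theorem norm_le_of_ae_hasDerivAt_damped (hνμ : ν < μ) (hK : 0 ≤ K)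
    (hv : AbsolutelyContinuousOnInterval v 0 T) (hv0 : v 0 = 0)
    (hv' : ∀ᵐ s, s ∈ Ioo 0 T → ∃ q, ‖q‖ ≤ K * Real.exp (-(ν * s)) ∧
      HasDerivAt v (-(μ • v s) - q) s)
    {t : ℝ} (ht : t ∈ Icc 0 T) : ‖v t‖ ≤ K / (μ - ν) * Real.exp (-(ν * t)) := by
  have hgap : 0 < μ - ν := sub_pos.2 hνμ
  have hexp : ∀ c s : ℝ, HasDerivAt (fun s => Real.exp (c * s)) (Real.exp (c * s) * c) s :=
    fun c s => by simpa using ((hasDerivAt_id s).const_mul c).exp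
  have hexp_ac : ∀ c : ℝ, AbsolutelyContinuousOnInterval (fun s => Real.exp (c * s)) 0 T :=
    fun c => ContDiffOn.absolutelyContinuousOnInterval (by fun_prop)
  have hintegrated : ‖Real.exp (μ * t) • v t - Real.exp (μ * 0) • v 0‖ ≤
      K / (μ - ν) * Real.exp ((μ - ν) * t) - K / (μ - ν) * Real.exp ((μ - ν) * 0) := by
    refine norm_sub_le_sub_of_ae_norm_deriv_le (f := fun s => Real.exp (μ * s) • v s)
      (h := fun s => K / (μ - ν) * Real.exp ((μ - ν) * s))
      ((hexp_ac μ).fun_smul hv) ((hexp_ac (μ - ν)).const_mul _) ?_ ht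
    filter_upwards [hv'] with s hs hsT
    obtain ⟨q, hq, hderiv⟩ := hs hsT
    refine ⟨-(Real.exp (μ * s) • q), ((hexp μ s).fun_smul hderiv).congr_deriv (by module), ?_⟩
    rw [((hexp (μ - ν) s).const_mul _).deriv, norm_neg, norm_smul, Real.norm_eq_abs,
      Real.abs_exp]
    calc Real.exp (μ * s) * ‖q‖ ≤ Real.exp (μ * s) * (K * Real.exp (-(ν * s))) := by gcongr
      _ = K * Real.exp ((μ - ν) * s) := by
        rw [mul_left_comm, ← Real.exp_add]; ring_nf
      _ = _ := by field_simp
  have hsplit : Real.exp ((μ - ν) * t) = Real.exp (μ * t) * Real.exp (-(ν * t)) := by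
    rw [← Real.exp_add]; ring_nf
  rw [hv0, smul_zero, sub_zero, norm_smul, Real.norm_eq_abs, Real.abs_exp, hsplit] at hintegrated
  have hnonneg : 0 ≤ K / (μ - ν) * Real.exp ((μ - ν) * 0) := by positivity
  refine le_of_mul_le_mul_left ?_ (Real.exp_pos (μ * t))
  linarith

theorem norm_sub_le_of_norm_velocity_le (hν : 0 < ν) (hK : 0 ≤ K)
    (hw : ∀ t ∈ Icc 0 T, HasDerivWithinAt w (v t) (Icc 0 T) t)
    (hv : ∀ t ∈ Icc 0 T, ‖v t‖ ≤ K * Real.exp (-(ν * t))) {t : ℝ} (ht : t ∈ Icc 0 T) :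
    ‖w t - w 0‖ ≤ K / ν := by
  have hbound := image_norm_le_of_norm_deriv_right_le_deriv_boundary
    (f := fun s => w s - w 0) (B := fun s => K / ν * (1 - Real.exp (-(ν * s))))
    (B' := fun s => K * Real.exp (-(ν * s)))
    (fun s hs => (hw s hs).continuousWithinAt.sub continuousWithinAt_const)
    (fun s hs => ((hw s (Ico_subset_Icc_self hs)).mono_of_mem_nhdsWithin
      (Icc_mem_nhdsGE_of_mem hs)).sub_const _)
    (by simp)
    (fun s => ((((((hasDerivAt_id s).const_mul ν).fun_neg).exp).const_sub 1).const_mul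
      (K / ν)).congr_deriv (by simp; field_simp))
    (fun s hs => hv s (Ico_subset_Icc_self hs)) ht
  refine hbound.trans (mul_le_of_le_one_right (by positivity) ?_)
  linarith [Real.exp_pos (-(ν * t))]

end DampedMotion

section Pseudoinverse

open ContinuousLinearMap

variable {U F : Type*} [NormedAddCommGroup U] [InnerProductSpace ℝ U] [CompleteSpace U]
  [NormedAddCommGroup F] [InnerProductSpace ℝ F] [CompleteSpace F]

/-- The Moore-Penrose inverse `A† (A A†)⁻¹` of a surjective bounded operator. It is the junk value
`0` when `A A†` is not invertible. -/
noncomputable def pseudoinverse (A : F →L[ℝ] U) : U →L[ℝ] F :=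
  adjoint A ∘L Ring.inverse (A ∘L adjoint A)

variable {A : F →L[ℝ] U} {c : ℝ}

theorem inner_comp_adjoint_self (A : F →L[ℝ] U) (z : U) :
    inner ℝ ((A ∘L adjoint A) z) z = ‖adjoint A z‖ ^ 2 := by
  rw [comp_apply, ← adjoint_inner_right, real_inner_self_eq_norm_sq]

theorem apply_pseudoinverse (hc : 0 < c) (hA : ∀ z, c * ‖z‖ ≤ ‖adjoint A z‖) (z : U) :
    A (pseudoinverse A z) = z := by
  have hunit : IsUnit (A ∘L adjoint A) := by
    refine isUnit_of_forall_le_norm_inner_map _ (c := .mk (c ^ 2) (sq_nonneg c)) (pow_pos hc 2)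
      fun z => ?_
    rw [inner_comp_adjoint_self, Real.norm_of_nonneg (sq_nonneg _), NNReal.coe_mk, ← mul_pow,
      mul_comm]
    exact pow_le_pow_left₀ (by positivity) (hA z) 2
  exact congr($(Ring.mul_inverse_cancel _ hunit) z)

theorem inner_pseudoinverse_eq_norm_sq (hc : 0 < c) (hA : ∀ z, c * ‖z‖ ≤ ‖adjoint A z‖) (v : F) :
    inner ℝ (pseudoinverse A (A v)) v = ‖pseudoinverse A (A v)‖ ^ 2 := by
  set u := Ring.inverse (A ∘L adjoint A) (A v)
  calc inner ℝ (adjoint A u) v = inner ℝ u (A v) := adjoint_inner_left A v u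
    _ = inner ℝ u (A (pseudoinverse A (A v))) := by rw [apply_pseudoinverse hc hA]
    _ = inner ℝ (adjoint A u) (adjoint A u) := (adjoint_inner_left A (adjoint A u) u).symm
    _ = ‖adjoint A u‖ ^ 2 := real_inner_self_eq_norm_sq _

theorem inner_pseudoinverse_apply_self_le (hc : 0 < c) (hA : ∀ z, c * ‖z‖ ≤ ‖adjoint A z‖)
    (v : F) : inner ℝ (pseudoinverse A (A v)) v ≤ ‖v‖ ^ 2 := by
  have hcs := real_inner_le_norm (pseudoinverse A (A v)) v
  rw [inner_pseudoinverse_eq_norm_sq hc hA] at hcs ⊢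
  nlinarith [norm_nonneg v, norm_nonneg (pseudoinverse A (A v))]

theorem norm_pseudoinverse_le (hc : 0 < c) (hA : ∀ z, c * ‖z‖ ≤ ‖adjoint A z‖) :
    ‖pseudoinverse A‖ ≤ c⁻¹ := by
  refine opNorm_le_bound _ (by positivity) fun z => ?_
  set u := Ring.inverse (A ∘L adjoint A) z
  have hsq : ‖adjoint A u‖ ^ 2 ≤ ‖z‖ * ‖u‖ :=
    calc ‖adjoint A u‖ ^ 2 = inner ℝ (A (pseudoinverse A z)) u := (inner_comp_adjoint_self A u).symm
      _ = inner ℝ z u := by rw [apply_pseudoinverse hc hA]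
      _ ≤ ‖z‖ * ‖u‖ := real_inner_le_norm z u
  change ‖adjoint A u‖ ≤ c⁻¹ * ‖z‖
  rw [inv_mul_eq_div, le_div_iff₀ hc]
  rcases (norm_nonneg (adjoint A u)).eq_or_lt with hzero | hpos
  · simp [← hzero]
  · refine le_of_mul_le_mul_left ?_ hpos
    calc ‖adjoint A u‖ * (‖adjoint A u‖ * c) = c * ‖adjoint A u‖ ^ 2 := by ring
      _ ≤ c * (‖z‖ * ‖u‖) := by gcongr
      _ = (c * ‖u‖) * ‖z‖ := by ring
      _ ≤ ‖adjoint A u‖ * ‖z‖ := by gcongr; exact hA u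

end Pseudoinverse

section Lyapunov

open Set ContinuousLinearMap

variable {U F : Type*} [NormedAddCommGroup U] [InnerProductSpace ℝ U] [NormedAddCommGroup F]
  [InnerProductSpace ℝ F] {ρ κ : ℝ} {M : U →L[ℝ] F}

/-- The Lyapunov function `½‖Δ‖² + ½‖V‖² + ρ⟨M Δ, V⟩` of the system `Δ' = J V`,
`V' = -2ρ V - J† Δ`. For `M` a right inverse of the Jacobian `J`, the vector `M Δ` plays the role
of the displacement from a minimizer in the usual energy of a heavy ball with friction `2ρ`. -/
noncomputable def heavyBallEnergy (ρ : ℝ) (M : U →L[ℝ] F) (Δ : U) (V : F) : ℝ :=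
  1 / 2 * ‖Δ‖ ^ 2 + 1 / 2 * ‖V‖ ^ 2 + ρ * inner ℝ (M Δ) V

theorem abs_mul_inner_le (hρ : 0 ≤ ρ) (hM : ρ * ‖M‖ ≤ κ) (Δ : U) (V : F) :
    |ρ * inner ℝ (M Δ) V| ≤ κ * (‖Δ‖ * ‖V‖) :=
  calc |ρ * inner ℝ (M Δ) V| = ρ * |inner ℝ (M Δ) V| := by rw [abs_mul, abs_of_nonneg hρ]
    _ ≤ ρ * (‖M‖ * ‖Δ‖ * ‖V‖) := by
      gcongr
      exact (abs_real_inner_le_norm _ _).trans (by gcongr; exact M.le_opNorm Δ)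
    _ = ρ * ‖M‖ * (‖Δ‖ * ‖V‖) := by ring
    _ ≤ κ * (‖Δ‖ * ‖V‖) := by gcongr

theorem one_sub_sq_mul_norm_sq_le_heavyBallEnergy (hρ : 0 ≤ ρ) (hM : ρ * ‖M‖ ≤ κ) (Δ : U) (V : F) :
    (1 - κ ^ 2) * ‖Δ‖ ^ 2 ≤ 2 * heavyBallEnergy ρ M Δ V := by
  have := (abs_le.mp (abs_mul_inner_le hρ hM Δ V)).1
  rw [heavyBallEnergy]
  nlinarith [sq_nonneg (‖V‖ - κ * ‖Δ‖)]

theorem absolutelyContinuousOnInterval_heavyBallEnergy (M : U →L[ℝ] F) {Δ : ℝ → U} {V : ℝ → F}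
    {a b : ℝ} (hΔ : AbsolutelyContinuousOnInterval Δ a b)
    (hV : AbsolutelyContinuousOnInterval V a b) :
    AbsolutelyContinuousOnInterval (fun t => heavyBallEnergy ρ M (Δ t) (V t)) a b := by
  have hMΔ := absolutelyContinuousOnInterval_lipschitzWith_comp M.lipschitz hΔ
  simp only [heavyBallEnergy, ← real_inner_self_eq_norm_sq]
  exact (((absolutelyContinuousOnInterval_inner hΔ hΔ).const_mul _).fun_add
    ((absolutelyContinuousOnInterval_inner hV hV).const_mul _)).fun_add
    ((absolutelyContinuousOnInterval_inner hMΔ hV).const_mul _)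

theorem hasDerivAt_heavyBallEnergy (M : U →L[ℝ] F) {Δ : ℝ → U} {V : ℝ → F} {Δ' : U} {V' : F}
    {t : ℝ} (hΔ : HasDerivAt Δ Δ' t) (hV : HasDerivAt V V' t) :
    HasDerivAt (fun s => heavyBallEnergy ρ M (Δ s) (V s))
      (inner ℝ (Δ t) Δ' + inner ℝ (V t) V' +
        ρ * (inner ℝ (M Δ') (V t) + inner ℝ (M (Δ t)) V')) t := by
  have hMΔ : HasDerivAt (fun s => M (Δ s)) (M Δ') t := M.hasFDerivAt.comp_hasDerivAt t hΔ
  exact (((hΔ.norm_sq.const_mul (1 / 2)).fun_add (hV.norm_sq.const_mul (1 / 2))).fun_add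
    ((hMΔ.inner ℝ hV).const_mul ρ)).congr_deriv (by ring)

variable [CompleteSpace U] [CompleteSpace F] {A J : F →L[ℝ] U}

theorem heavyBallEnergy_dissipation (hρ : 0 < ρ) (hAM : ∀ z, A (M z) = z)
    (hMA : ∀ v, inner ℝ (M (A v)) v ≤ ‖v‖ ^ 2) (hM : ρ * ‖M‖ ≤ κ)
    (hJA : ‖J - A‖ * ‖M‖ ≤ (1 - κ) / 2) (Δ : U) (V : F) :
    inner ℝ Δ (J V) + inner ℝ V (-((2 * ρ) • V) - adjoint J Δ) +
        ρ * (inner ℝ (M (J V)) V + inner ℝ (M Δ) (-((2 * ρ) • V) - adjoint J Δ)) ≤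
      -(ρ * heavyBallEnergy ρ M Δ V) := by
  set E := J - A
  have hJ : ∀ v, J v = A v + E v := fun v => by simp [E]
  have hME : inner ℝ (M (E V)) V ≤ (1 - κ) / 2 * ‖V‖ ^ 2 :=
    calc inner ℝ (M (E V)) V ≤ ‖M (E V)‖ * ‖V‖ := real_inner_le_norm _ _
      _ ≤ ‖M‖ * (‖E‖ * ‖V‖) * ‖V‖ := by
        gcongr; exact M.le_opNorm_of_le (E.le_opNorm V)
      _ = ‖E‖ * ‖M‖ * ‖V‖ ^ 2 := by ring
      _ ≤ (1 - κ) / 2 * ‖V‖ ^ 2 := by gcongr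
  have hEM : -inner ℝ (E (M Δ)) Δ ≤ (1 - κ) / 2 * ‖Δ‖ ^ 2 :=
    calc -inner ℝ (E (M Δ)) Δ ≤ ‖E (M Δ)‖ * ‖Δ‖ :=
          (neg_le_abs _).trans (abs_real_inner_le_norm _ _)
      _ ≤ ‖E‖ * (‖M‖ * ‖Δ‖) * ‖Δ‖ := by
        gcongr; exact E.le_opNorm_of_le (M.le_opNorm Δ)
      _ = ‖E‖ * ‖M‖ * ‖Δ‖ ^ 2 := by ring
      _ ≤ (1 - κ) / 2 * ‖Δ‖ ^ 2 := by gcongr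
  have hMJ : inner ℝ (M (J V)) V = inner ℝ (M (A V)) V + inner ℝ (M (E V)) V := by
    rw [hJ, map_add, inner_add_left]
  have hJM : inner ℝ (M Δ) (adjoint J Δ) = ‖Δ‖ ^ 2 + inner ℝ (E (M Δ)) Δ := by
    rw [adjoint_inner_right, hJ, inner_add_left, hAM, real_inner_self_eq_norm_sq]
  have hskew : inner ℝ V (adjoint J Δ) = inner ℝ Δ (J V) := by
    rw [adjoint_inner_right, real_inner_comm]
  have hcross := (abs_le.mp (abs_mul_inner_le hρ.le hM Δ V)).1
  have hbracket : inner ℝ (M (A V)) V + inner ℝ (M (E V)) V - inner ℝ (E (M Δ)) Δ -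
      ρ * inner ℝ (M Δ) V ≤ 1 / 2 * ‖Δ‖ ^ 2 + 3 / 2 * ‖V‖ ^ 2 := by
    have hκ : 0 ≤ κ := (by positivity : 0 ≤ ρ * ‖M‖).trans hM
    nlinarith [hMA V, mul_nonneg hκ (sq_nonneg (‖Δ‖ - ‖V‖))]
  simp only [heavyBallEnergy, inner_sub_right, inner_neg_right, real_inner_smul_right, hMJ, hJM,
    hskew, real_inner_self_eq_norm_sq]
  linarith [mul_le_mul_of_nonneg_left hbracket hρ.le]

theorem norm_sq_le_exp_mul_of_heavyBall (hρ : 0 < ρ) (hκ : 0 < κ)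
    (hA : ∀ z, ρ / κ * ‖z‖ ≤ ‖adjoint A z‖) {T : ℝ} {Δ : ℝ → U} {V : ℝ → F}
    (hΔ : AbsolutelyContinuousOnInterval Δ 0 T) (hV : AbsolutelyContinuousOnInterval V 0 T)
    (hV0 : V 0 = 0)
    (hflow : ∀ᵐ t, t ∈ Ioo 0 T → ∃ J : F →L[ℝ] U, ‖J - A‖ ≤ (1 - κ) / 2 * (ρ / κ) ∧
      HasDerivAt Δ (J (V t)) t ∧ HasDerivAt V (-((2 * ρ) • V t) - adjoint J (Δ t)) t)
    {t : ℝ} (ht : t ∈ Icc 0 T) :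
    (1 - κ ^ 2) * ‖Δ t‖ ^ 2 ≤ Real.exp (-(ρ * t)) * ‖Δ 0‖ ^ 2 := by
  have hc : 0 < ρ / κ := by positivity
  set M := pseudoinverse A
  have hMc : ρ / κ * ‖M‖ ≤ 1 := by
    rw [← le_inv_mul_iff₀ hc, mul_one]
    exact norm_pseudoinverse_le hc hA
  have hM : ρ * ‖M‖ ≤ κ := by
    rwa [div_mul_eq_mul_div, div_le_one₀ hκ] at hMc
  have hdecay := le_exp_mul_of_ae_deriv_le_neg_mul (ρ := ρ)
    (absolutelyContinuousOnInterval_heavyBallEnergy M hΔ hV) (by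
      filter_upwards [hflow] with s hs hsT
      obtain ⟨J, hJ, hΔ', hV'⟩ := hs hsT
      rw [(hasDerivAt_heavyBallEnergy M hΔ' hV').deriv]
      refine heavyBallEnergy_dissipation hρ (apply_pseudoinverse hc hA)
        (inner_pseudoinverse_apply_self_le hc hA) hM ?_ _ _
      have hκ1 : 0 ≤ (1 - κ) / 2 := nonneg_of_mul_nonneg_left ((norm_nonneg _).trans hJ) hc
      calc ‖J - A‖ * ‖M‖ ≤ (1 - κ) / 2 * (ρ / κ) * ‖M‖ := by gcongr
        _ = (1 - κ) / 2 * (ρ / κ * ‖M‖) := by ring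
        _ ≤ (1 - κ) / 2 := mul_le_of_le_one_right hκ1 hMc) ht
  have hinit : heavyBallEnergy ρ M (Δ 0) (V 0) = 1 / 2 * ‖Δ 0‖ ^ 2 := by
    simp [heavyBallEnergy, hV0]
  have hlower := one_sub_sq_mul_norm_sq_le_heavyBallEnergy hρ.le hM (Δ t) (V t)
  rw [hinit, sub_zero] at hdecay
  linarith

end Lyapunov

section Bootstrap

open Set

theorem forall_lt_of_bootstrap {h : ℝ → ℝ} {a R : ℝ} (hc : ContinuousOn h (Ici a))
    (hstep : ∀ T, a ≤ T → (∀ t ∈ Ico a T, h t < R) → h T < R) {t : ℝ} (ht : a ≤ t) : h t < R := by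
  by_contra! hRt
  have hclosed : IsClosed (Ici a ∩ h ⁻¹' Ici R) :=
    hc.preimage_isClosed_of_isClosed isClosed_Ici isClosed_Ici
  have hbdd : BddBelow (Ici a ∩ h ⁻¹' Ici R) := ⟨a, fun _ hs => hs.1⟩
  have hexit := hclosed.csInf_mem ⟨t, ht, hRt⟩ hbdd
  refine (hstep _ hexit.1 fun s hs => ?_).not_ge hexit.2
  by_contra! hRs
  exact hs.2.not_ge (csInf_le hbdd ⟨hs.1, hRs⟩)

end Bootstrap

section Relu

open Filter

theorem lipschitzWith_relu : LipschitzWith 1 relu :=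
  LipschitzWith.of_dist_le_mul fun a b => by
    simpa [relu, Real.dist_eq] using abs_max_sub_max_le_abs a b 0

theorem relu_neg (z : ℝ) : relu (-z) = relu z - z := by
  rcases le_total 0 z with h | h <;> simp [relu, h]

theorem isLocalMin_relu_comp {g : ℝ → ℝ} {t : ℝ} (hg : g t = 0) :
    IsLocalMin (fun τ => relu (g τ)) t :=
  Eventually.of_forall fun τ => by simp [hg, relu]

theorem hasDerivAt_relu_comp {g : ℝ → ℝ} {g' t s : ℝ} (hg : HasDerivAt g g' t)
    (hd : DifferentiableAt ℝ (fun τ => relu (g τ)) t) (hs : s ∈ reluSubdiff (g t)) :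
    HasDerivAt (fun τ => relu (g τ)) (s * g') t := by
  obtain ⟨-, -, hpos, hneg⟩ := hs
  rcases lt_trichotomy (g t) 0 with h | h | h
  · rw [hneg h, zero_mul]
    refine (hasDerivAt_const t (0 : ℝ)).congr_of_eventuallyEq ?_
    filter_upwards [hg.continuousAt.eventually_lt_const h] with τ hτ
    exact max_eq_right hτ.le
  · -- `relu ∘ g` and `relu ∘ (-g)` are both minimal at `t`, and they differ by `g`, so `g' = 0`.
    have hzero : HasDerivAt (fun τ => relu (g τ)) 0 t :=
      (isLocalMin_relu_comp h).deriv_eq_zero ▸ hd.hasDerivAt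
    have hzero_neg : HasDerivAt (fun τ => relu (-g τ)) (0 - g') t := by
      simpa only [relu_neg] using hzero.fun_sub hg
    have hg' : g' = 0 := by
      linarith [(isLocalMin_relu_comp (g := fun τ => -g τ) (by simp [h])).hasDerivAt_eq_zero
        hzero_neg]
    rwa [hg', mul_zero]
  · rw [hpos h, one_mul]
    refine hg.congr_of_eventuallyEq ?_
    filter_upwards [hg.continuousAt.eventually_const_lt h] with τ hτ
    exact max_eq_left hτ.le

end Relu

section AnalysisOperator

open ContinuousLinearMap

variable {ι F : Type*} [NormedAddCommGroup F] [InnerProductSpace ℝ F]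

/-- The analysis operator `v ↦ (⟪φ i, v⟫)ᵢ` of a finite family of vectors. It is the derivative of
a vector-valued map whose components have the gradients `φ i`. -/
noncomputable def analysisOp (φ : ι → F) : F →L[ℝ] EuclideanSpace ℝ ι :=
  (EuclideanSpace.equiv ι ℝ).symm.toContinuousLinearMap ∘L
    ContinuousLinearMap.pi fun i => innerSL ℝ (φ i)

theorem analysisOp_apply (φ : ι → F) (v : F) (i : ι) : analysisOp φ v i = inner ℝ (φ i) v := rfl

variable [Fintype ι]

theorem analysisOp_sub (φ ψ : ι → F) : analysisOp (φ - ψ) = analysisOp φ - analysisOp ψ := by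
  ext v i
  simp [analysisOp_apply, inner_sub_left]

theorem norm_analysisOp_le (φ : ι → F) : ‖analysisOp φ‖ ≤ √(∑ i, ‖φ i‖ ^ 2) := by
  refine opNorm_le_bound _ (Real.sqrt_nonneg _) fun v => ?_
  rw [← Real.sqrt_sq (norm_nonneg v), ← Real.sqrt_mul (by positivity), EuclideanSpace.norm_eq]
  refine Real.sqrt_le_sqrt ?_
  rw [Finset.sum_mul]
  refine Finset.sum_le_sum fun i _ => ?_
  rw [analysisOp_apply, ← mul_pow]
  exact pow_le_pow_left₀ (norm_nonneg _) (norm_inner_le_norm _ _) 2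

variable [CompleteSpace F]

theorem adjoint_analysisOp_apply (φ : ι → F) (z : EuclideanSpace ℝ ι) :
    adjoint (analysisOp φ) z = ∑ i, z i • φ i := by
  refine ext_inner_right ℝ fun v => ?_
  simp [adjoint_inner_left, PiLp.inner_apply, analysisOp_apply, sum_inner, inner_smul_left,
    mul_comm]

theorem norm_sq_adjoint_analysisOp (φ : ι → F) (z : EuclideanSpace ℝ ι) :
    ‖adjoint (analysisOp φ) z‖ ^ 2 = z.ofLp ⬝ᵥ (Matrix.gram ℝ φ).mulVec z.ofLp := by
  rw [adjoint_analysisOp_apply, ← real_inner_self_eq_norm_sq, ← Matrix.star_dotProduct_gram_mulVec,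
    star_trivial]

end AnalysisOperator

section NetworkGradient

open ContinuousLinearMap

/-- The Hilbert space of the hidden weights `W = (w₁, …, w_m)`, with the Frobenius norm. -/
abbrev Params (m p : ℕ) : Type := PiLp 2 fun _ : Fin m => EuclideanSpace ℝ (Fin p)

variable {m n p : ℕ}

/-- The gradient in the hidden weights of the network output at the `i`-th input, where `s r i` is
the value used for `σ'(wᵣᵀxᵢ)`. -/
noncomputable def networkGrad (x : Fin n → EuclideanSpace ℝ (Fin p)) (a : Fin m → ℝ)
    (s : Fin m → Fin n → ℝ) (i : Fin n) : Params m p :=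
  WithLp.toLp 2 fun r => (1 / √m * a r * s r i) • x i

open Classical in
/-- The derivative `𝟙(wᵣᵀxᵢ ≥ 0)` of the ReLU at the preactivation of neuron `r` on input `i`, with
the convention of `ntkMatrix` at the kink. -/
noncomputable def activation (x : Fin n → EuclideanSpace ℝ (Fin p))
    (W : Fin m → EuclideanSpace ℝ (Fin p)) (r : Fin m) (i : Fin n) : ℝ :=
  if 0 ≤ inner ℝ (W r) (x i) then 1 else 0

/-- The prediction error `predError` as an element of Euclidean space. -/
noncomputable def errorVec (x : Fin n → EuclideanSpace ℝ (Fin p)) (y : Fin n → ℝ) (a : Fin m → ℝ)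
    (W : Fin m → EuclideanSpace ℝ (Fin p)) : EuclideanSpace ℝ (Fin n) :=
  WithLp.toLp 2 (predError x y W a)

open Classical in
/-- The number of pairs `(r, i)` with `|wᵣᵀxᵢ| ≤ R`, divided by `m`: only these activations can
change while every weight stays within distance `R`. -/
noncomputable def flipFraction (x : Fin n → EuclideanSpace ℝ (Fin p)) (R : ℝ)
    (W : Fin m → EuclideanSpace ℝ (Fin p)) : ℝ :=
  1 / (m : ℝ) * ∑ i, ∑ r, if |inner ℝ (W r) (x i)| ≤ R then 1 else 0

variable {x : Fin n → EuclideanSpace ℝ (Fin p)} {y : Fin n → ℝ} {a : Fin m → ℝ}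
  {W W₀ : Fin m → EuclideanSpace ℝ (Fin p)} {s s' : Fin m → Fin n → ℝ}

theorem loss_eq_norm_sq_errorVec : loss x y W a = 1 / 2 * ‖errorVec x y a W‖ ^ 2 := by
  rw [EuclideanSpace.real_norm_sq_eq]; rfl

theorem networkGrad_sub : networkGrad x a s - networkGrad x a s' = networkGrad x a (s - s') := by
  ext i r : 2
  simp only [networkGrad, Pi.sub_apply, PiLp.sub_apply]
  module

theorem inner_networkGrad (i : Fin n) (V : Params m p) :
    inner ℝ (networkGrad x a s i) V = 1 / √m * ∑ r, a r * (s r i * inner ℝ (V r) (x i)) := by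
  rw [PiLp.inner_apply, Finset.mul_sum]
  refine Finset.sum_congr rfl fun r _ => ?_
  rw [networkGrad, real_inner_smul_left, real_inner_comm]
  ring

theorem inner_networkGrad_networkGrad (ha : ∀ r, a r ^ 2 = 1) (i j : Fin n) :
    inner ℝ (networkGrad x a s i) (networkGrad x a s' j) =
      1 / (m : ℝ) * inner ℝ (x i) (x j) * ∑ r, s r i * s' r j := by
  have hm : (1 / √(m : ℝ)) ^ 2 = 1 / m := by simp
  rw [inner_networkGrad, Finset.mul_sum, Finset.mul_sum]
  refine Finset.sum_congr rfl fun r _ => ?_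
  rw [networkGrad, real_inner_smul_left, real_inner_comm, ← hm]
  linear_combination ((1 / √(m : ℝ)) ^ 2 * inner ℝ (x i) (x j) * s r i * s' r j) * ha r

theorem norm_sq_networkGrad (ha : ∀ r, a r ^ 2 = 1) (i : Fin n) :
    ‖networkGrad x a s i‖ ^ 2 = 1 / (m : ℝ) * ‖x i‖ ^ 2 * ∑ r, s r i ^ 2 := by
  rw [← real_inner_self_eq_norm_sq, inner_networkGrad_networkGrad ha, real_inner_self_eq_norm_sq]
  simp only [sq]

theorem gram_networkGrad_activation (ha : ∀ r, a r ^ 2 = 1) :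
    Matrix.gram ℝ (networkGrad x a (activation x W)) = ntkMatrix x W := by
  ext i j
  rw [Matrix.gram_apply, inner_networkGrad_networkGrad ha, ntkMatrix, Matrix.of_apply]
  simp only [activation, ite_and, ite_mul, one_mul, zero_mul]

theorem lossGrad_eq_adjoint_analysisOp (r : Fin m) :
    lossGrad x y W a s r =
      adjoint (analysisOp (networkGrad x a s)) (errorVec x y a W) r := by
  rw [adjoint_analysisOp_apply]
  simp [lossGrad, errorVec, networkGrad, mul_smul]

theorem norm_lossGrad_le (hx : ∀ i, ‖x i‖ ≤ 1) (ha : ∀ r, |a r| ≤ 1) {r : Fin m}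
    (hs : ∀ i, |s r i| ≤ 1) : ‖lossGrad x y W a s r‖ ≤ √n / √m * ‖errorVec x y a W‖ := by
  have hsum : ∑ i, |predError x y W a i| ≤ √n * ‖errorVec x y a W‖ := by
    have hsq := sq_sum_le_card_mul_sum_sq (s := Finset.univ) (f := fun i => |predError x y W a i|)
    calc ∑ i, |predError x y W a i| ≤ √(n * ∑ i, |predError x y W a i| ^ 2) :=
          Real.le_sqrt_of_sq_le (by simpa using hsq)
      _ = √n * ‖errorVec x y a W‖ := by
        rw [Real.sqrt_mul (Nat.cast_nonneg n), EuclideanSpace.norm_eq]; rfl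
  calc ‖lossGrad x y W a s r‖ ≤ ∑ i, 1 / √m * |predError x y W a i| := by
        refine (norm_sum_le _ _).trans (Finset.sum_le_sum fun i _ => ?_)
        have : |a r| * |s r i| * ‖x i‖ ≤ 1 :=
          mul_le_one₀ (mul_le_one₀ (ha r) (abs_nonneg _) (hs i)) (norm_nonneg _) (hx i)
        rw [norm_smul, Real.norm_eq_abs, abs_mul, abs_mul, abs_mul,
          abs_of_nonneg (by positivity : 0 ≤ 1 / √(m : ℝ))]
        calc _ = 1 / √m * |predError x y W a i| * (|a r| * |s r i| * ‖x i‖) := by ring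
          _ ≤ _ := mul_le_of_le_one_right (by positivity) this
    _ = 1 / √m * ∑ i, |predError x y W a i| := by rw [Finset.mul_sum]
    _ ≤ 1 / √m * (√n * ‖errorVec x y a W‖) := by gcongr
    _ = √n / √m * ‖errorVec x y a W‖ := by ring

open Classical in
theorem sq_sub_activation_le_of_mem_reluSubdiff (hx : ∀ i, ‖x i‖ ≤ 1) {R : ℝ} {r : Fin m}
    {i : Fin n} (hW : ‖W r - W₀ r‖ ≤ R) {σ : ℝ} (hσ : σ ∈ reluSubdiff (inner ℝ (W r) (x i))) :
    (σ - activation x W₀ r i) ^ 2 ≤ if |inner ℝ (W₀ r) (x i)| ≤ R then 1 else 0 := by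
  obtain ⟨hnonneg, hle_one, hpos, hneg⟩ := hσ
  have hclose : |inner ℝ (W r) (x i) - inner ℝ (W₀ r) (x i)| ≤ R := by
    rw [← inner_sub_left]
    exact (abs_real_inner_le_norm _ _).trans
      ((mul_le_of_le_one_right (norm_nonneg _) (hx i)).trans hW)
  rw [abs_le] at hclose
  unfold activation
  split_ifs with hact hnear hnear
  · nlinarith
  · rw [abs_of_nonneg hact, not_le] at hnear
    rw [hpos (by linarith)]; norm_num
  · nlinarith
  · rw [not_le] at hact
    rw [abs_of_neg hact, not_le] at hnear
    rw [hneg (by linarith)]; norm_num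

theorem norm_analysisOp_networkGrad_sub_le (hx : ∀ i, ‖x i‖ ≤ 1) (ha : ∀ r, a r ^ 2 = 1) {R : ℝ}
    (hW : ∀ r, ‖W r - W₀ r‖ ≤ R) (hs : ∀ r i, s r i ∈ reluSubdiff (inner ℝ (W r) (x i))) :
    ‖analysisOp (networkGrad x a s) - analysisOp (networkGrad x a (activation x W₀))‖ ≤
      √(flipFraction x R W₀) := by
  rw [← analysisOp_sub, networkGrad_sub]
  refine (norm_analysisOp_le _).trans (Real.sqrt_le_sqrt ?_)
  rw [flipFraction, Finset.mul_sum]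
  refine Finset.sum_le_sum fun i _ => ?_
  rw [norm_sq_networkGrad ha]
  gcongr with r
  · exact mul_le_of_le_one_right (by positivity) (pow_le_one₀ (norm_nonneg _) (hx i))
  · exact sq_sub_activation_le_of_mem_reluSubdiff hx (hW r) (hs r i)

end NetworkGradient

section Flow

open Set ContinuousLinearMap

theorem hasDerivAt_toLp {ι : Type*} [Fintype ι] {X : ι → Type*} [∀ i, NormedAddCommGroup (X i)]
    [∀ i, NormedSpace ℝ (X i)] {f : ℝ → ∀ i, X i} {f' : PiLp 2 X} {t : ℝ}
    (hf : ∀ i, HasDerivAt (fun τ => f τ i) (f' i) t) :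
    HasDerivAt (fun τ => (WithLp.toLp 2 (f τ) : PiLp 2 X)) f' t :=
  (PiLp.hasFDerivAt_toLp 2 (f t)).comp_hasDerivAt t (hasDerivAt_pi.2 hf)

variable {m n p : ℕ} {x : Fin n → EuclideanSpace ℝ (Fin p)} {y : Fin n → ℝ} {a : Fin m → ℝ}
  {W V : ℝ → Fin m → EuclideanSpace ℝ (Fin p)} {b t T : ℝ}

theorem absolutelyContinuousOnInterval_relu_inner {w : ℝ → EuclideanSpace ℝ (Fin p)}
    (hw : AbsolutelyContinuousOnInterval w b T) (u : EuclideanSpace ℝ (Fin p)) :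
    AbsolutelyContinuousOnInterval (fun t => relu (inner ℝ (w t) u)) b T :=
  absolutelyContinuousOnInterval_lipschitzWith_comp lipschitzWith_relu
    (absolutelyContinuousOnInterval_inner hw (absolutelyContinuousOnInterval_const u b T))

theorem absolutelyContinuousOnInterval_errorVec
    (hW : ∀ r, AbsolutelyContinuousOnInterval (fun t => W t r) b T) :
    AbsolutelyContinuousOnInterval (fun t => errorVec x y a (W t)) b T :=
  absolutelyContinuousOnInterval_toLp fun i =>
    ((absolutelyContinuousOnInterval_finset_sum _ fun r _ =>
      (absolutelyContinuousOnInterval_relu_inner (hW r) (x i)).const_mul (a r)).const_mul _).fun_sub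
        (absolutelyContinuousOnInterval_const (y i) b T)

theorem hasDerivAt_errorVec {v : Params m p} (hW : ∀ r, HasDerivAt (fun τ => W τ r) (v r) t)
    (hd : ∀ r i, DifferentiableAt ℝ (fun τ => relu (inner ℝ (W τ r) (x i))) t)
    {s : Fin m → Fin n → ℝ} (hs : ∀ r i, s r i ∈ reluSubdiff (inner ℝ (W t r) (x i))) :
    HasDerivAt (fun τ => errorVec x y a (W τ)) (analysisOp (networkGrad x a s) v) t := by
  refine hasDerivAt_toLp fun i => ?_
  rw [analysisOp_apply, inner_networkGrad]
  have hpre : ∀ r, HasDerivAt (fun τ => inner ℝ (W τ r) (x i)) (inner ℝ (v r) (x i)) t :=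
    fun r => by simpa using (hW r).inner ℝ (hasDerivAt_const t (x i))
  exact ((HasDerivAt.fun_sum fun r _ =>
    (hasDerivAt_relu_comp (hpre r) (hd r i) (hs r i)).const_mul (a r)).const_mul _).sub_const (y i)

/-- `V` is a velocity of the Heavy Ball flow `W`: the conditions of `IsHeavyBallFlow`, with the
equation of motion solved for the acceleration. -/
structure IsHeavyBallVelocity (b : ℝ) (x : Fin n → EuclideanSpace ℝ (Fin p)) (y : Fin n → ℝ)
    (a : Fin m → ℝ) (W V : ℝ → Fin m → EuclideanSpace ℝ (Fin p)) : Prop where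
  hasDerivWithinAt : ∀ t, 0 ≤ t → ∀ r, HasDerivWithinAt (fun τ => W τ r) (V t r) (Ici 0) t
  initial_eq_zero : ∀ r, V 0 r = 0
  absolutelyContinuous : ∀ T, 0 ≤ T → ∀ r, AbsolutelyContinuousOnInterval (fun τ => V τ r) 0 T
  ae_hasDerivAt : ∀ᵐ t, 0 ≤ t → ∃ s : Fin m → Fin n → ℝ,
    (∀ r i, s r i ∈ reluSubdiff (inner ℝ (W t r) (x i))) ∧
    ∀ r, HasDerivAt (fun τ => V τ r) (-(b • V t r) - lossGrad x y (W t) a s r) t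

theorem IsHeavyBallFlow.exists_velocity (hW : IsHeavyBallFlow b x y a W) :
    ∃ V, IsHeavyBallVelocity b x y a W V := by
  obtain ⟨V, hderiv, hzero, hac, hode⟩ := hW
  refine ⟨V, hderiv, hzero, hac, ?_⟩
  filter_upwards [(ae_restrict_iff' measurableSet_Ici).1 hode] with t hode_t ht
  obtain ⟨s, hs, hacc⟩ := hode_t ht
  refine ⟨s, hs, fun r => ?_⟩
  obtain ⟨A, hA, hsum⟩ := hacc r
  refine hA.congr_deriv ?_
  rw [← sub_eq_zero, ← hsum]
  abel

namespace IsHeavyBallVelocity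

theorem hasDerivAt (hV : IsHeavyBallVelocity b x y a W V) (ht : 0 < t) (r : Fin m) :
    HasDerivAt (fun τ => W τ r) (V t r) t :=
  (hV.hasDerivWithinAt t ht.le r).hasDerivAt (Ici_mem_nhds ht)

theorem hasDerivWithinAt_Icc (hV : IsHeavyBallVelocity b x y a W V) (r : Fin m)
    (ht : t ∈ Icc 0 T) : HasDerivWithinAt (fun τ => W τ r) (V t r) (Icc 0 T) t :=
  (hV.hasDerivWithinAt t ht.1 r).mono Icc_subset_Ici_self

theorem absolutelyContinuous_path (hV : IsHeavyBallVelocity b x y a W V) (hT : 0 ≤ T) (r : Fin m) :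
    AbsolutelyContinuousOnInterval (fun τ => W τ r) 0 T :=
  absolutelyContinuousOnInterval_of_hasDerivWithinAt
    (by rw [uIcc_of_le hT]; exact fun t ht => hV.hasDerivWithinAt_Icc r ht)
    (hV.absolutelyContinuous T hT r)

theorem continuousOn_path (hV : IsHeavyBallVelocity b x y a W V) : ContinuousOn W (Ici 0) :=
  continuousOn_pi.2 fun r t ht => (hV.hasDerivWithinAt t ht r).continuousWithinAt

theorem ae_hasDerivAt_errorVec (hV : IsHeavyBallVelocity b x y a W V) :
    ∀ᵐ t, t ∈ Ioo 0 T → ∃ s : Fin m → Fin n → ℝ,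
      (∀ r i, s r i ∈ reluSubdiff (inner ℝ (W t r) (x i))) ∧
      HasDerivAt (fun τ => errorVec x y a (W τ))
        (analysisOp (networkGrad x a s) (WithLp.toLp 2 (V t) : Params m p)) t ∧
      ∀ r, HasDerivAt (fun τ => V τ r)
        (-(b • V t r) - adjoint (analysisOp (networkGrad x a s)) (errorVec x y a (W t)) r) t := by
  rcases le_or_gt T 0 with hT | hT
  · simp [Ioo_eq_empty_of_le hT]
  have hrelu : ∀ᵐ t, ∀ r i, t ∈ uIcc 0 T →
      DifferentiableAt ℝ (fun τ => relu (inner ℝ (W τ r) (x i))) t :=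
    ae_all_iff.2 fun r => ae_all_iff.2 fun i => (absolutelyContinuousOnInterval_relu_inner
      (hV.absolutelyContinuous_path hT.le r) (x i)).ae_differentiableAt
  filter_upwards [hV.ae_hasDerivAt, hrelu] with t hode hdiff ht
  have hmem : t ∈ uIcc 0 T := by rw [uIcc_of_le hT.le]; exact Ioo_subset_Icc_self ht
  obtain ⟨s, hs, hacc⟩ := hode ht.1.le
  exact ⟨s, hs, hasDerivAt_errorVec (hV.hasDerivAt ht.1) (fun r i => hdiff r i hmem) hs,
    fun r => lossGrad_eq_adjoint_analysisOp r ▸ hacc r⟩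

theorem norm_sq_errorVec_le {ρ κ R : ℝ} (hV : IsHeavyBallVelocity (2 * ρ) x y a W V) (hρ : 0 < ρ)
    (hκ : 0 < κ) (hx : ∀ i, ‖x i‖ ≤ 1) (ha : ∀ r, a r ^ 2 = 1)
    (hH : ∀ z : Fin n → ℝ, (ρ / κ) ^ 2 * ∑ i, z i ^ 2 ≤ z ⬝ᵥ (ntkMatrix x (W 0)).mulVec z)
    (hflip : √(flipFraction x R (W 0)) ≤ (1 - κ) / 2 * (ρ / κ))
    (hR : ∀ s ∈ Ioo 0 T, ∀ r, ‖W s r - W 0 r‖ ≤ R) (ht : t ∈ Icc 0 T) :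
    (1 - κ ^ 2) * ‖errorVec x y a (W t)‖ ^ 2 ≤
      Real.exp (-(ρ * t)) * ‖errorVec x y a (W 0)‖ ^ 2 := by
  have hT : 0 ≤ T := ht.1.trans ht.2
  refine norm_sq_le_exp_mul_of_heavyBall (V := fun t => WithLp.toLp 2 (V t))
    (A := analysisOp (networkGrad x a (activation x (W 0)))) hρ hκ (fun z => ?_)
    (absolutelyContinuousOnInterval_errorVec (hV.absolutelyContinuous_path hT))
    (absolutelyContinuousOnInterval_toLp (hV.absolutelyContinuous T hT))
    (by ext1 r; exact hV.initial_eq_zero r) ?_ ht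
  · rw [← sq_le_sq₀ (by positivity) (norm_nonneg _), mul_pow, norm_sq_adjoint_analysisOp,
      gram_networkGrad_activation ha, EuclideanSpace.real_norm_sq_eq]
    exact hH z
  · filter_upwards [hV.ae_hasDerivAt_errorVec (T := T)] with s hs hsT
    obtain ⟨σ, hσ, hΔ, hacc⟩ := hs hsT
    exact ⟨_, (norm_analysisOp_networkGrad_sub_le hx ha (hR s hsT) hσ).trans hflip, hΔ,
      hasDerivAt_toLp hacc⟩

theorem norm_sub_initial_le {ν P : ℝ} (hV : IsHeavyBallVelocity b x y a W V) (hν : 0 < ν)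
    (hνb : ν < b) (hP : 0 ≤ P) (hx : ∀ i, ‖x i‖ ≤ 1) (ha : ∀ r, |a r| ≤ 1)
    (hdecay : ∀ s ∈ Ioo 0 T, ‖errorVec x y a (W s)‖ ≤ P * Real.exp (-(ν * s)))
    (ht : t ∈ Icc 0 T) (r : Fin m) : ‖W t r - W 0 r‖ ≤ √n / √m * P / (b - ν) / ν := by
  have : 0 < b - ν := sub_pos.2 hνb
  refine norm_sub_le_of_norm_velocity_le (w := fun t => W t r) hν (by positivity)
    (fun s hs => hV.hasDerivWithinAt_Icc r hs) (fun s hs => ?_) ht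
  refine norm_le_of_ae_hasDerivAt_damped hνb (by positivity)
    (hV.absolutelyContinuous T (ht.1.trans ht.2) r) (hV.initial_eq_zero r) ?_ hs
  filter_upwards [hV.ae_hasDerivAt] with τ hτ hτT
  obtain ⟨σ, hσ, hacc⟩ := hτ hτT.1.le
  refine ⟨_, ?_, hacc r⟩
  calc ‖lossGrad x y (W τ) a σ r‖ ≤ √n / √m * ‖errorVec x y a (W τ)‖ :=
        norm_lossGrad_le hx ha fun i =>
          abs_le.2 ⟨by linarith [(hσ r i).1], (hσ r i).2.1⟩
    _ ≤ √n / √m * (P * Real.exp (-(ν * τ))) := by gcongr; exact hdecay τ hτT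
    _ = √n / √m * P * Real.exp (-(ν * τ)) := by ring

/-- The bootstrap: while no weight has left the ball of radius `R` the error decays, and while the
error decays no weight can leave that ball. -/
theorem norm_sq_errorVec_le_of_displacement_lt {ρ κ R : ℝ}
    (hV : IsHeavyBallVelocity (2 * ρ) x y a W V) (hρ : 0 < ρ) (hκ : 0 < κ) (hκ' : κ < 1)
    (hx : ∀ i, ‖x i‖ ≤ 1) (ha : ∀ r, a r ^ 2 = 1)
    (hH : ∀ z : Fin n → ℝ, (ρ / κ) ^ 2 * ∑ i, z i ^ 2 ≤ z ⬝ᵥ (ntkMatrix x (W 0)).mulVec z)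
    (hflip : √(flipFraction x R (W 0)) ≤ (1 - κ) / 2 * (ρ / κ))
    (hR : √n / √m * (‖errorVec x y a (W 0)‖ / √(1 - κ ^ 2)) / (2 * ρ - ρ / 2) / (ρ / 2) < R)
    (ht : 0 ≤ t) :
    (1 - κ ^ 2) * ‖errorVec x y a (W t)‖ ^ 2 ≤
      Real.exp (-(ρ * t)) * ‖errorVec x y a (W 0)‖ ^ 2 := by
  have hκsq : 0 < 1 - κ ^ 2 := by nlinarith
  have hRpos : 0 < R :=
    lt_of_le_of_lt (div_nonneg (div_nonneg (by positivity) (by linarith)) (by positivity)) hR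
  have hstay : ∀ s, 0 ≤ s → ‖W s - W 0‖ < R := fun s hs => by
    refine forall_lt_of_bootstrap (a := 0) (hV.continuousOn_path.sub continuousOn_const).norm
      (fun T hT hball => (pi_norm_lt_iff hRpos).2 fun r => lt_of_le_of_lt ?_ hR) hs
    refine hV.norm_sub_initial_le (half_pos hρ) (by linarith) (by positivity) hx
      (fun r => (sq_le_one_iff_abs_le_one _).1 (ha r).le) (fun τ hτ => ?_) (right_mem_Icc.2 hT) r
    have hclose : ∀ τ ∈ Ioo 0 T, ∀ r, ‖W τ r - W 0 r‖ ≤ R := fun τ hτ =>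
      (pi_norm_le_iff_of_nonneg hRpos.le).1 (hball τ (Ioo_subset_Ico_self hτ)).le
    have hdecay := hV.norm_sq_errorVec_le hρ hκ hx ha hH hflip hclose (Ioo_subset_Icc_self hτ)
    have hexp : Real.exp (-(ρ * τ)) = Real.exp (-(ρ / 2 * τ)) ^ 2 := by
      rw [← Real.exp_nat_mul]; ring_nf
    rw [← sq_le_sq₀ (norm_nonneg _) (by positivity), mul_pow, div_pow, Real.sq_sqrt hκsq.le,
      div_mul_eq_mul_div, le_div_iff₀' hκsq, mul_comm (_ ^ 2), ← hexp]
    exact hdecay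
  refine hV.norm_sq_errorVec_le hρ hκ hx ha hH hflip (T := t) (fun s hs r => ?_) ⟨ht, le_rfl⟩
  exact (norm_le_pi_norm (W s - W 0) r).trans (hstay s hs.1.le).le

end IsHeavyBallVelocity

end Flow

section Spectral

theorem lambdaMin_le_of_mem_spectrum {n : ℕ} {A : Matrix (Fin n) (Fin n) ℝ} {μ : ℝ}
    (hμ : μ ∈ spectrum ℝ A) : lambdaMin A ≤ μ := by
  have hfinite : {ν : ℝ | Module.End.HasEigenvalue (Matrix.toLin' A) ν}.Finite :=
    Module.End.finite_hasEigenvalue _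
  refine csInf_le hfinite.bddBelow ?_
  rwa [Set.mem_ofPred_eq, Module.End.hasEigenvalue_iff_mem_spectrum, Matrix.spectrum_toLin']

theorem posSemidef_sub_algebraMap_lambdaMin {n : ℕ} {A : Matrix (Fin n) (Fin n) ℝ}
    (hA : A.IsHermitian) : (A - algebraMap ℝ _ (lambdaMin A)).PosSemidef := by
  rw [Matrix.posSemidef_iff_isHermitian_and_spectrum_nonneg]
  refine ⟨hA.sub ?_, fun μ hμ => ?_⟩
  · rw [Algebra.algebraMap_eq_smul_one]
    exact Matrix.isHermitian_one.smul (IsSelfAdjoint.all _)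
  · rw [← spectrum.sub_singleton_eq] at hμ
    obtain ⟨ν, hν, _, rfl, rfl⟩ := hμ
    exact sub_nonneg.2 (lambdaMin_le_of_mem_spectrum hν)

theorem lambdaMin_mul_sum_sq_le {n : ℕ} {A : Matrix (Fin n) (Fin n) ℝ} (hA : A.IsHermitian)
    (z : Fin n → ℝ) : lambdaMin A * ∑ i, z i ^ 2 ≤ z ⬝ᵥ A.mulVec z := by
  have hnonneg := (posSemidef_sub_algebraMap_lambdaMin hA).dotProduct_mulVec_nonneg z
  rw [Matrix.sub_mulVec, dotProduct_sub, Algebra.algebraMap_eq_smul_one, Matrix.smul_mulVec,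
    Matrix.one_mulVec, dotProduct_smul] at hnonneg
  simpa only [star_trivial, smul_eq_mul, dotProduct, sub_nonneg, sq] using hnonneg

theorem sq_dotProduct_mulVec_le {ι : Type*} [Fintype ι] (M : Matrix ι ι ℝ) (z : ι → ℝ) :
    (z ⬝ᵥ M.mulVec z) ^ 2 ≤ (∑ i, ∑ j, M i j ^ 2) * (∑ i, z i ^ 2) ^ 2 := by
  have hform : z ⬝ᵥ M.mulVec z = ∑ i, ∑ j, M i j * (z i * z j) := by
    simp only [dotProduct, Matrix.mulVec, Finset.mul_sum]
    exact Finset.sum_congr rfl fun i _ => Finset.sum_congr rfl fun j _ => by ring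
  have hcauchy := Finset.sum_mul_sq_le_sq_mul_sq Finset.univ
    (fun ij : ι × ι => M ij.1 ij.2) (fun ij => z ij.1 * z ij.2)
  simp only [Fintype.sum_prod_type, mul_pow] at hcauchy
  rwa [← Finset.sum_mul_sum, ← sq (∑ i, z i ^ 2), ← hform] at hcauchy

theorem dotProduct_mulVec_ge_of_sum_sq_sub_le {ι : Type*} [Fintype ι] {A H : Matrix ι ι ℝ} {c : ℝ}
    (hc : 0 ≤ c) (hAH : ∑ i, ∑ j, (H i j - A i j) ^ 2 ≤ c ^ 2) (z : ι → ℝ) :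
    z ⬝ᵥ A.mulVec z - c * ∑ i, z i ^ 2 ≤ z ⬝ᵥ H.mulVec z := by
  have hsq : (z ⬝ᵥ (H - A).mulVec z) ^ 2 ≤ (c * ∑ i, z i ^ 2) ^ 2 :=
    (sq_dotProduct_mulVec_le (H - A) z).trans <| by
      rw [mul_pow]
      exact mul_le_mul_of_nonneg_right hAH (sq_nonneg _)
  have hlower := (abs_le_of_sq_le_sq' hsq (by positivity)).1
  rw [Matrix.sub_mulVec, dotProduct_sub] at hlower
  linarith

end Spectral

section Moments

theorem measureReal_ge_le_of_integral_le {Ω : Type*} [MeasurableSpace Ω] {μ : Measure Ω}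
    {f : Ω → ℝ} (hf : 0 ≤ f) (hfi : Integrable f μ) {θ η : ℝ} (hθ : 0 < θ)
    (hη : ∫ ω, f ω ∂μ ≤ η * θ) : μ.real {ω | θ ≤ f ω} ≤ η := by
  have hmarkov := mul_meas_ge_le_integral_of_nonneg (Filter.Eventually.of_forall hf) hfi θ
  exact le_of_mul_le_mul_left (by linarith) hθ

theorem memLp_sum_eval_pi {ι : Type*} [Fintype ι] {Ω : ι → Type*} [∀ r, MeasurableSpace (Ω r)]
    {μ : ∀ r, Measure (Ω r)} [∀ r, IsProbabilityMeasure (μ r)] {X : ∀ r, Ω r → ℝ} {q : ENNReal}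
    (hX : ∀ r, MemLp (X r) q (μ r)) : MemLp (fun ω => ∑ r, X r (ω r)) q (Measure.pi μ) :=
  memLp_finsetSum _ fun r _ => (hX r).comp_measurePreserving (measurePreserving_eval μ r)

theorem integral_sum_eval_pi {ι : Type*} [Fintype ι] {Ω : ι → Type*} [∀ r, MeasurableSpace (Ω r)]
    {μ : ∀ r, Measure (Ω r)} [∀ r, IsProbabilityMeasure (μ r)] {X : ∀ r, Ω r → ℝ}
    (hX : ∀ r, Integrable (X r) (μ r)) :
    ∫ ω, ∑ r, X r (ω r) ∂(Measure.pi μ) = ∑ r, ∫ z, X r z ∂(μ r) := by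
  rw [integral_finsetSum _ fun r _ => integrable_comp_eval (hX r)]
  exact Finset.sum_congr rfl fun r _ => integral_comp_eval (hX r).aestronglyMeasurable

theorem integral_sq_sum_sub_pi {ι : Type*} [Fintype ι] {Ω : ι → Type*}
    [∀ r, MeasurableSpace (Ω r)] {μ : ∀ r, Measure (Ω r)} [∀ r, IsProbabilityMeasure (μ r)]
    {X : ∀ r, Ω r → ℝ} (hX : ∀ r, MemLp (X r) 2 (μ r)) {c : ι → ℝ}
    (hc : ∀ r, ∫ z, X r z ∂(μ r) = c r) :
    ∫ ω, (∑ r, X r (ω r) - ∑ r, c r) ^ 2 ∂(Measure.pi μ) = ∑ r, Var[X r; μ r] := by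
  simp only [← hc]
  rw [← variance_sum_pi hX, ← integral_sum_eval_pi fun r => (hX r).integrable one_le_two,
    ← variance_eq_integral (memLp_sum_eval_pi hX).aemeasurable]
  congr 1
  ext ω
  simp

theorem gaussianReal_le_mul_volume (μ : ℝ) {v : NNReal} (hv : v ≠ 0) (s : Set ℝ) :
    gaussianReal μ v s ≤ ENNReal.ofReal (√(2 * Real.pi * v))⁻¹ * volume s := by
  rw [gaussianReal_apply _ hv, ← setLIntegral_const]
  refine lintegral_mono fun z => ENNReal.ofReal_le_ofReal ?_
  refine mul_le_of_le_one_right (by positivity) (Real.exp_le_one_iff.2 ?_)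
  rw [neg_div, neg_nonpos]
  positivity

section StdGaussian

variable {E : Type*} [NormedAddCommGroup E] [InnerProductSpace ℝ E] [FiniteDimensional ℝ E]
  [MeasurableSpace E] [BorelSpace E]

theorem memLp_inner_stdGaussian (u : E) : MemLp (fun w => inner ℝ w u) 2 (stdGaussian E) := by
  simpa only [innerSL_apply_apply, real_inner_comm] using!
    IsGaussian.memLp_dual (stdGaussian E) (innerSL ℝ u) 2 (by simp)

theorem integral_sq_inner_stdGaussian (u : E) :
    ∫ w, inner ℝ w u ^ 2 ∂(stdGaussian E) = ‖u‖ ^ 2 := by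
  have hvar := variance_of_integral_eq_zero (innerSL ℝ u).continuous.aemeasurable
    (integral_strongDual_stdGaussian (innerSL ℝ u))
  rw [variance_dual_stdGaussian, innerSL_apply_norm] at hvar
  simp only [hvar, innerSL_apply_apply, real_inner_comm]

theorem map_inner_stdGaussian (u : E) :
    (stdGaussian E).map (fun w => inner ℝ w u) = gaussianReal 0 (‖u‖ ^ 2).toNNReal := by
  have hmap := IsGaussian.map_eq_gaussianReal (μ := stdGaussian E) (innerSL ℝ u)
  rw [integral_strongDual_stdGaussian, variance_dual_stdGaussian, innerSL_apply_norm] at hmap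
  rw [← hmap]
  congr 1
  ext w
  exact real_inner_comm u w

theorem stdGaussian_abs_inner_le_le {u : E} (hu : ‖u‖ = 1) {R : ℝ} (hR : 0 ≤ R) :
    (stdGaussian E).real {w | |inner ℝ w u| ≤ R} ≤ R := by
  have hpi : 2 ≤ √(2 * Real.pi) := Real.le_sqrt_of_sq_le (by linarith [Real.pi_gt_three])
  refine ENNReal.toReal_le_of_le_ofReal hR ?_
  calc stdGaussian E {w | |inner ℝ w u| ≤ R}
      = (stdGaussian E).map (fun w => inner ℝ w u) (Set.Icc (-R) R) := by
        rw [Measure.map_apply (by fun_prop) measurableSet_Icc]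
        simp only [Set.preimage, Set.mem_Icc, abs_le]
    _ ≤ ENNReal.ofReal (√(2 * Real.pi))⁻¹ * volume (Set.Icc (-R) R) := by
        rw [map_inner_stdGaussian, hu]
        simpa using gaussianReal_le_mul_volume 0 one_ne_zero (Set.Icc (-R) R)
    _ ≤ ENNReal.ofReal 2⁻¹ * ENNReal.ofReal (R - -R) := by
        rw [Real.volume_Icc]
        gcongr
    _ = ENNReal.ofReal R := by
        rw [← ENNReal.ofReal_mul (by norm_num)]
        congr 1; ring

end StdGaussian

section Signs

instance : IsProbabilityMeasure signMeasure := by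
  constructor
  simp [signMeasure, ENNReal.inv_two_add_inv_two]

theorem ae_sq_eq_one_signMeasure : ∀ᵐ z ∂signMeasure, z ^ 2 = 1 := by
  simp [signMeasure, ae_add_measure_iff, ae_dirac_eq]

theorem memLp_id_signMeasure : MemLp (fun z : ℝ => z) 2 signMeasure := by
  refine MemLp.of_bound aestronglyMeasurable_id 1 ?_
  filter_upwards [ae_sq_eq_one_signMeasure] with z hz
  exact (sq_le_one_iff_abs_le_one z).1 hz.le

theorem integral_id_signMeasure : ∫ z, z ∂signMeasure = 0 := by
  rw [signMeasure, integral_add_measure ((integrable_dirac (by simp)).smul_measure (by simp))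
    ((integrable_dirac (by simp)).smul_measure (by simp)), integral_smul_measure,
    integral_smul_measure]
  simp

theorem variance_id_signMeasure : Var[fun z => z; signMeasure] = 1 := by
  rw [variance_of_integral_eq_zero memLp_id_signMeasure.aemeasurable integral_id_signMeasure,
    integral_congr_ae ae_sq_eq_one_signMeasure]
  simp

end Signs

end Moments

section KernelTerm

open Classical in
/-- The summand `uᵀv 𝟙(wᵀu ≥ 0, wᵀv ≥ 0)` contributed by a neuron with weight `w` to the entry of
the kernel at the inputs `u` and `v`. -/
noncomputable def kernelTerm {E : Type*} [NormedAddCommGroup E] [InnerProductSpace ℝ E]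
    (u v w : E) : ℝ :=
  inner ℝ u v * (if 0 ≤ inner ℝ w u ∧ 0 ≤ inner ℝ w v then (1 : ℝ) else 0)

section InnerProductSpace

variable {E : Type*} [NormedAddCommGroup E] [InnerProductSpace ℝ E] {u v : E}

theorem kernelTerm_comm (u v : E) : kernelTerm u v = kernelTerm v u := by
  ext w
  simp only [kernelTerm, real_inner_comm u v, and_comm]

theorem abs_kernelTerm_le_one (hu : ‖u‖ ≤ 1) (hv : ‖v‖ ≤ 1) (w : E) : |kernelTerm u v w| ≤ 1 := by
  have hinner : |inner ℝ u v| ≤ 1 :=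
    (abs_real_inner_le_norm u v).trans (mul_le_one₀ hu (norm_nonneg v) hv)
  unfold kernelTerm
  split_ifs
  · simpa using hinner
  · simp

variable [MeasurableSpace E] [BorelSpace E] [SecondCountableTopology E]

theorem measurable_kernelTerm (u v : E) : Measurable (kernelTerm u v) := by
  have hhalfspace (z : E) : MeasurableSet {w | 0 ≤ inner ℝ w z} :=
    measurableSet_le measurable_const (by fun_prop)
  exact (Measurable.ite ((hhalfspace u).inter (hhalfspace v)) measurable_const
    measurable_const).const_mul _

theorem memLp_kernelTerm (hu : ‖u‖ ≤ 1) (hv : ‖v‖ ≤ 1) (q : ENNReal) (μ : Measure E)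
    [IsFiniteMeasure μ] : MemLp (kernelTerm u v) q μ :=
  MemLp.of_bound (measurable_kernelTerm u v).aestronglyMeasurable 1
    (Filter.Eventually.of_forall (abs_kernelTerm_le_one hu hv))

theorem variance_kernelTerm_le_one (hu : ‖u‖ ≤ 1) (hv : ‖v‖ ≤ 1) (μ : Measure E)
    [IsProbabilityMeasure μ] : Var[kernelTerm u v; μ] ≤ 1 := by
  have hbound := variance_le_sq_of_bounded (μ := μ)
    (Filter.Eventually.of_forall fun w => abs_le.1 (abs_kernelTerm_le_one hu hv w))
    (measurable_kernelTerm u v).aemeasurable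
  linarith

end InnerProductSpace

variable {m n p : ℕ} {x : Fin n → EuclideanSpace ℝ (Fin p)}

theorem ntkMatrix_apply (x : Fin n → EuclideanSpace ℝ (Fin p))
    (W : Fin m → EuclideanSpace ℝ (Fin p)) (i j : Fin n) :
    ntkMatrix x W i j = ∑ r, 1 / (m : ℝ) * kernelTerm (x i) (x j) (W r) := by
  simp only [ntkMatrix, Matrix.of_apply, kernelTerm, Finset.mul_sum, mul_assoc]

theorem limitNTK_apply (x : Fin n → EuclideanSpace ℝ (Fin p)) (i j : Fin n) :
    limitNTK x i j = ∫ w, kernelTerm (x i) (x j) w ∂(stdGaussian (EuclideanSpace ℝ (Fin p))) :=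
  rfl

theorem isHermitian_limitNTK (x : Fin n → EuclideanSpace ℝ (Fin p)) :
    (limitNTK x).IsHermitian := by
  ext i j
  rw [Matrix.conjTranspose_apply, star_trivial, limitNTK_apply, limitNTK_apply, kernelTerm_comm]

theorem abs_limitNTK_apply_le_one (hx : ∀ i, ‖x i‖ ≤ 1) (i j : Fin n) : |limitNTK x i j| ≤ 1 := by
  have hnorm := norm_integral_le_of_norm_le_const (f := kernelTerm (x i) (x j)) (C := 1)
    (μ := stdGaussian (EuclideanSpace ℝ (Fin p)))
    (Filter.Eventually.of_forall fun w => abs_kernelTerm_le_one (hx i) (hx j) w)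
  rwa [probReal_univ, mul_one, ← limitNTK_apply] at hnorm

theorem lambdaMin_limitNTK_le_one (hn : 0 < n) (hx : ∀ i, ‖x i‖ ≤ 1) :
    lambdaMin (limitNTK x) ≤ 1 := by
  let i : Fin n := ⟨0, hn⟩
  have hrayleigh := lambdaMin_mul_sum_sq_le (isHermitian_limitNTK x) (Pi.single i 1)
  have hunit : ∑ j, (Pi.single i 1 : Fin n → ℝ) j ^ 2 = 1 := by simp [Pi.single_apply]
  rw [hunit, mul_one, Matrix.mulVec_single_one, single_one_dotProduct] at hrayleigh
  exact hrayleigh.trans ((le_abs_self _).trans (abs_limitNTK_apply_le_one hx i i))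

/-- The squared Frobenius distance `‖H(W) - H^∞‖²` from the finite-width kernel to its limit. -/
noncomputable def kernelDeviation (x : Fin n → EuclideanSpace ℝ (Fin p))
    (W : Fin m → EuclideanSpace ℝ (Fin p)) : ℝ :=
  ∑ i, ∑ j, (ntkMatrix x W i j - limitNTK x i j) ^ 2

end KernelTerm

section Initialization

variable {m n p : ℕ} {x : Fin n → EuclideanSpace ℝ (Fin p)} {y : Fin n → ℝ}

instance : IsProbabilityMeasure (initLaw m p) := by
  unfold initLaw; infer_instance

theorem integral_initLaw_comp_fst (f : (Fin m → EuclideanSpace ℝ (Fin p)) → ℝ) :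
    ∫ ω, f ω.1 ∂(initLaw m p) =
      ∫ W, f W ∂(Measure.pi fun _ : Fin m => stdGaussian (EuclideanSpace ℝ (Fin p))) := by
  rw [initLaw, integral_fun_fst, probReal_univ, one_smul]

theorem measurePreserving_initLaw_weight (r : Fin m) :
    MeasurePreserving (fun ω => ω.1 r) (initLaw m p) (stdGaussian (EuclideanSpace ℝ (Fin p))) :=
  (measurePreserving_eval _ r).comp measurePreserving_fst

theorem measurePreserving_initLaw_sign (r : Fin m) :
    MeasurePreserving (fun ω => ω.2 r) (initLaw m p) signMeasure :=
  (measurePreserving_eval _ r).comp measurePreserving_snd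

theorem ae_sq_eq_one_initLaw : ∀ᵐ ω ∂(initLaw m p), ∀ r, ω.2 r ^ 2 = 1 :=
  ae_all_iff.2 fun r =>
    (measurePreserving_initLaw_sign r).quasiMeasurePreserving.ae ae_sq_eq_one_signMeasure

section Kernel

theorem memLp_ntkMatrix_apply (hx : ∀ i, ‖x i‖ ≤ 1) (i j : Fin n) :
    MemLp (fun ω => ntkMatrix x ω.1 i j) 2 (initLaw m p) := by
  simp only [ntkMatrix_apply]
  exact memLp_finsetSum _ fun r _ => ((memLp_kernelTerm (hx i) (hx j) 2 _).const_mul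
    (1 / (m : ℝ))).comp_measurePreserving (measurePreserving_initLaw_weight r)

theorem integral_sq_ntkMatrix_sub_limitNTK_le (hm : 0 < m) (hx : ∀ i, ‖x i‖ ≤ 1) (i j : Fin n) :
    ∫ ω, (ntkMatrix x ω.1 i j - limitNTK x i j) ^ 2 ∂(initLaw m p) ≤ 1 / m := by
  have hm' : (0 : ℝ) < m := Nat.cast_pos.2 hm
  have hmean : ∫ w, 1 / (m : ℝ) * kernelTerm (x i) (x j) w
      ∂(stdGaussian (EuclideanSpace ℝ (Fin p))) = 1 / (m : ℝ) * limitNTK x i j := by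
    rw [integral_const_mul, limitNTK_apply]
  have hcentre : ∑ _r : Fin m, 1 / (m : ℝ) * limitNTK x i j = limitNTK x i j := by
    simp [hm'.ne']
  have hvar : ∫ W : Fin m → EuclideanSpace ℝ (Fin p), (ntkMatrix x W i j - limitNTK x i j) ^ 2
        ∂(Measure.pi fun _ => stdGaussian (EuclideanSpace ℝ (Fin p))) =
      ∑ _r : Fin m, Var[fun w => 1 / (m : ℝ) * kernelTerm (x i) (x j) w;
        stdGaussian (EuclideanSpace ℝ (Fin p))] := by
    simp only [ntkMatrix_apply]
    nth_rw 1 [← hcentre]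
    exact integral_sq_sum_sub_pi
      (fun _ => (memLp_kernelTerm (hx i) (hx j) 2 _).const_mul (1 / (m : ℝ))) fun _ => hmean
  rw [integral_initLaw_comp_fst fun W => (ntkMatrix x W i j - limitNTK x i j) ^ 2, hvar]
  calc ∑ _r : Fin m, Var[fun w => 1 / (m : ℝ) * kernelTerm (x i) (x j) w;
        stdGaussian (EuclideanSpace ℝ (Fin p))]
      ≤ ∑ _r : Fin m, (1 / (m : ℝ)) ^ 2 * 1 := by
        gcongr
        rw [variance_const_mul]
        gcongr
        exact variance_kernelTerm_le_one (hx i) (hx j) _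
    _ = 1 / m := by
        rw [Finset.sum_const, Finset.card_univ, Fintype.card_fin, nsmul_eq_mul]
        field_simp

theorem integrable_sq_ntkMatrix_sub_limitNTK (hx : ∀ i, ‖x i‖ ≤ 1) (i j : Fin n) :
    Integrable (fun ω => (ntkMatrix x ω.1 i j - limitNTK x i j) ^ 2) (initLaw m p) :=
  ((memLp_ntkMatrix_apply hx i j).sub (memLp_const _)).integrable_sq

theorem measurable_kernelDeviation (x : Fin n → EuclideanSpace ℝ (Fin p)) :
    Measurable fun W : Fin m → EuclideanSpace ℝ (Fin p) => kernelDeviation x W := by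
  have hterm (i j : Fin n) := measurable_kernelTerm (x i) (x j)
  simp only [kernelDeviation, ntkMatrix_apply]
  fun_prop

theorem integrable_kernelDeviation (hx : ∀ i, ‖x i‖ ≤ 1) :
    Integrable (fun ω => kernelDeviation x ω.1) (initLaw m p) :=
  integrable_finsetSum _ fun i _ => integrable_finsetSum _ fun j _ =>
    integrable_sq_ntkMatrix_sub_limitNTK hx i j

theorem integral_kernelDeviation_le (hm : 0 < m) (hx : ∀ i, ‖x i‖ ≤ 1) :
    ∫ ω, kernelDeviation x ω.1 ∂(initLaw m p) ≤ (n : ℝ) ^ 2 / m := by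
  have hint := integrable_sq_ntkMatrix_sub_limitNTK (m := m) hx
  unfold kernelDeviation
  rw [integral_finsetSum _ fun i _ => integrable_finsetSum _ fun j _ => hint i j]
  calc _ ≤ ∑ _i : Fin n, ∑ _j : Fin n, 1 / (m : ℝ) := by
        gcongr with i
        rw [integral_finsetSum _ fun j _ => hint i j]
        gcongr with j
        exact integral_sq_ntkMatrix_sub_limitNTK_le hm hx i j
    _ = (n : ℝ) ^ 2 / m := by
        simp only [Finset.sum_const, Finset.card_univ, Fintype.card_fin, nsmul_eq_mul]
        ring

end Kernel

section Flips

theorem measurableSet_abs_inner_le (u : EuclideanSpace ℝ (Fin p)) (R : ℝ) :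
    MeasurableSet {w | |inner ℝ w u| ≤ R} :=
  measurableSet_le (by fun_prop) measurable_const

theorem flipFraction_eq_sum_indicator (x : Fin n → EuclideanSpace ℝ (Fin p)) (R : ℝ)
    (W : Fin m → EuclideanSpace ℝ (Fin p)) :
    flipFraction x R W =
      ∑ r, 1 / (m : ℝ) * ∑ i, {w | |inner ℝ w (x i)| ≤ R}.indicator 1 (W r) := by
  rw [flipFraction, Finset.sum_comm, Finset.mul_sum]
  simp only [Set.indicator_apply, Set.mem_ofPred_eq, Pi.one_apply]

theorem integrable_sum_indicator_abs_inner_le (x : Fin n → EuclideanSpace ℝ (Fin p)) (R : ℝ) :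
    Integrable (fun w => 1 / (m : ℝ) * ∑ i, {w | |inner ℝ w (x i)| ≤ R}.indicator 1 w)
      (stdGaussian (EuclideanSpace ℝ (Fin p))) :=
  (integrable_finsetSum _ fun i _ =>
    (integrable_const 1).indicator (measurableSet_abs_inner_le (x i) R)).const_mul _

theorem measurable_flipFraction (x : Fin n → EuclideanSpace ℝ (Fin p)) (R : ℝ) :
    Measurable fun W : Fin m → EuclideanSpace ℝ (Fin p) => flipFraction x R W := by
  have hindicator (i : Fin n) : Measurable
      ({w | |inner ℝ w (x i)| ≤ R}.indicator (1 : EuclideanSpace ℝ (Fin p) → ℝ)) :=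
    measurable_one.indicator (measurableSet_abs_inner_le (x i) R)
  simp only [flipFraction_eq_sum_indicator]
  exact Finset.measurable_sum _ fun r _ => (Finset.measurable_sum _ fun i _ =>
    (hindicator i).comp (measurable_pi_apply r)).const_mul _

theorem integrable_flipFraction (x : Fin n → EuclideanSpace ℝ (Fin p)) (R : ℝ) :
    Integrable (fun ω => flipFraction x R ω.1) (initLaw m p) := by
  simp only [flipFraction_eq_sum_indicator]
  exact integrable_finsetSum _ fun r _ => (measurePreserving_initLaw_weight r
    ).integrable_comp_of_integrable (integrable_sum_indicator_abs_inner_le x R)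

theorem integral_flipFraction_le (hx : ∀ i, ‖x i‖ = 1) {R : ℝ} (hR : 0 ≤ R) :
    ∫ ω, flipFraction x R ω.1 ∂(initLaw m p) ≤ n * R := by
  have hweight : ∫ w, 1 / (m : ℝ) * ∑ i, {w | |inner ℝ w (x i)| ≤ R}.indicator 1 w
      ∂(stdGaussian (EuclideanSpace ℝ (Fin p))) ≤ 1 / (m : ℝ) * (n * R) := by
    rw [integral_const_mul, integral_finsetSum _ fun i _ =>
      (integrable_const 1).indicator (measurableSet_abs_inner_le (x i) R)]
    gcongr
    calc _ ≤ ∑ _i : Fin n, R := by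
          gcongr with i
          rw [integral_indicator_one (measurableSet_abs_inner_le (x i) R)]
          exact stdGaussian_abs_inner_le_le (hx i) hR
      _ = n * R := by simp
  rw [integral_initLaw_comp_fst (flipFraction x R)]
  simp only [flipFraction_eq_sum_indicator]
  rw [integral_sum_eval_pi fun _ => integrable_sum_indicator_abs_inner_le x R, Finset.sum_const,
    Finset.card_univ, Fintype.card_fin, nsmul_eq_mul]
  calc _ ≤ (m : ℝ) * (1 / (m : ℝ) * (n * R)) := by gcongr
    _ = (m : ℝ) * (m : ℝ)⁻¹ * (n * R) := by ring
    _ ≤ n * R := mul_le_of_le_one_left (by positivity) mul_inv_le_one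

end Flips

section Outputs

theorem network_eq_sum (W : Fin m → EuclideanSpace ℝ (Fin p)) (a : Fin m → ℝ)
    (u : EuclideanSpace ℝ (Fin p)) :
    network W a u = ∑ r, 1 / √m * relu (inner ℝ (W r) u) * a r := by
  rw [network, Finset.mul_sum]
  exact Finset.sum_congr rfl fun r _ => by ring

theorem measurable_network (u : EuclideanSpace ℝ (Fin p)) :
    Measurable fun ω : (Fin m → EuclideanSpace ℝ (Fin p)) × (Fin m → ℝ) =>
      network ω.1 ω.2 u := by
  have := lipschitzWith_relu.continuous.measurable
  unfold network
  fun_prop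

theorem abs_relu_le (z : ℝ) : |relu z| ≤ |z| := by
  rw [relu, abs_of_nonneg (le_max_right z 0)]
  exact max_le (le_abs_self z) (abs_nonneg z)

theorem memLp_network (u : EuclideanSpace ℝ (Fin p)) :
    MemLp (fun ω => network ω.1 ω.2 u) 2 (initLaw m p) := by
  have hrelu := lipschitzWith_relu.continuous.measurable
  have hneuron (r : Fin m) : MemLp (fun ω => ω.2 r * relu (inner ℝ (ω.1 r) u)) 2 (initLaw m p) := by
    have hinner : MemLp (fun ω => inner ℝ (ω.1 r) u) 2 (initLaw m p) :=
      (memLp_inner_stdGaussian u).comp_measurePreserving (measurePreserving_initLaw_weight r)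
    refine hinner.mono (Measurable.aestronglyMeasurable (by fun_prop)) ?_
    filter_upwards [ae_sq_eq_one_initLaw] with ω hω
    rw [norm_mul, Real.norm_eq_abs, (sq_eq_sq_iff_abs_eq_abs _ _).1 ((hω r).trans (one_pow 2).symm),
      abs_one, one_mul]
    exact abs_relu_le _
  exact (memLp_finsetSum _ fun r _ => hneuron r).const_mul _

theorem integral_sq_network_signs (W : Fin m → EuclideanSpace ℝ (Fin p))
    (u : EuclideanSpace ℝ (Fin p)) :
    ∫ a, network W a u ^ 2 ∂(Measure.pi fun _ : Fin m => signMeasure) =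
      ∑ r, 1 / (m : ℝ) * relu (inner ℝ (W r) u) ^ 2 := by
  have hmean (r : Fin m) : ∫ z, 1 / √m * relu (inner ℝ (W r) u) * z ∂signMeasure = 0 := by
    rw [integral_const_mul, integral_id_signMeasure, mul_zero]
  have hsum := integral_sq_sum_sub_pi
    (fun r => memLp_id_signMeasure.const_mul (1 / √m * relu (inner ℝ (W r) u))) hmean
  simp only [Finset.sum_const_zero, sub_zero, ← network_eq_sum] at hsum
  rw [hsum]
  refine Finset.sum_congr rfl fun r _ => ?_
  rw [variance_const_mul, variance_id_signMeasure, mul_one, mul_pow, div_pow, one_pow,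
    Real.sq_sqrt (Nat.cast_nonneg m)]

theorem integral_sq_network_le (u : EuclideanSpace ℝ (Fin p)) :
    ∫ ω, network ω.1 ω.2 u ^ 2 ∂(initLaw m p) ≤ ‖u‖ ^ 2 := by
  have hsq : Integrable (fun ω => network ω.1 ω.2 u ^ 2) (initLaw m p) :=
    (memLp_network u).integrable_sq
  have hweight : Integrable (fun w => 1 / (m : ℝ) * inner ℝ w u ^ 2)
      (stdGaussian (EuclideanSpace ℝ (Fin p))) :=
    (memLp_inner_stdGaussian u).integrable_sq.const_mul _
  have hweights : Integrable (fun W => ∑ r, 1 / (m : ℝ) * inner ℝ (W r) u ^ 2)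
      (Measure.pi fun _ : Fin m => stdGaussian (EuclideanSpace ℝ (Fin p))) :=
    integrable_finsetSum _ fun r _ =>
      (measurePreserving_eval (fun _ => stdGaussian (EuclideanSpace ℝ (Fin p)))
        r).integrable_comp_of_integrable hweight
  calc ∫ ω, network ω.1 ω.2 u ^ 2 ∂(initLaw m p)
      = ∫ W, ∑ r, 1 / (m : ℝ) * relu (inner ℝ (W r) u) ^ 2
          ∂(Measure.pi fun _ : Fin m => stdGaussian (EuclideanSpace ℝ (Fin p))) := by
        simp only [initLaw, integral_prod _ hsq, integral_sq_network_signs]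
    _ ≤ ∫ W, ∑ r, 1 / (m : ℝ) * inner ℝ (W r) u ^ 2
          ∂(Measure.pi fun _ : Fin m => stdGaussian (EuclideanSpace ℝ (Fin p))) := by
        refine integral_mono_of_nonneg (Filter.Eventually.of_forall fun W => by positivity)
          hweights (Filter.Eventually.of_forall fun W => ?_)
        exact Finset.sum_le_sum fun r _ =>
          mul_le_mul_of_nonneg_left (sq_le_sq.2 (abs_relu_le _)) (by positivity)
    _ = m * (m : ℝ)⁻¹ * ‖u‖ ^ 2 := by
        rw [integral_sum_eval_pi fun _ => hweight, integral_const_mul,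
          integral_sq_inner_stdGaussian]
        simp [mul_assoc]
    _ ≤ ‖u‖ ^ 2 := mul_le_of_le_one_left (sq_nonneg _) mul_inv_le_one

theorem measurable_norm_sq_errorVec (x : Fin n → EuclideanSpace ℝ (Fin p)) (y : Fin n → ℝ) :
    Measurable fun ω : (Fin m → EuclideanSpace ℝ (Fin p)) × (Fin m → ℝ) =>
      ‖errorVec x y ω.2 ω.1‖ ^ 2 := by
  simp only [EuclideanSpace.real_norm_sq_eq]
  exact Finset.measurable_sum _ fun i _ => ((measurable_network (x i)).sub_const (y i)).pow_const 2

theorem integrable_sq_network_sub (u : EuclideanSpace ℝ (Fin p)) (c : ℝ) :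
    Integrable (fun ω => (network ω.1 ω.2 u - c) ^ 2) (initLaw m p) :=
  ((memLp_network u).sub (memLp_const c)).integrable_sq

theorem integrable_norm_sq_errorVec (x : Fin n → EuclideanSpace ℝ (Fin p)) (y : Fin n → ℝ) :
    Integrable (fun ω => ‖errorVec x y ω.2 ω.1‖ ^ 2) (initLaw m p) := by
  simp only [EuclideanSpace.real_norm_sq_eq]
  exact integrable_finsetSum _ fun i _ => integrable_sq_network_sub (x i) (y i)

theorem integral_sq_network_sub_le (u : EuclideanSpace ℝ (Fin p)) (c : ℝ) :
    ∫ ω, (network ω.1 ω.2 u - c) ^ 2 ∂(initLaw m p) ≤ 2 * (‖u‖ ^ 2 + c ^ 2) := by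
  have hsq : Integrable (fun ω => network ω.1 ω.2 u ^ 2) (initLaw m p) :=
    (memLp_network u).integrable_sq
  calc ∫ ω, (network ω.1 ω.2 u - c) ^ 2 ∂(initLaw m p)
      ≤ ∫ ω, 2 * (network ω.1 ω.2 u ^ 2 + c ^ 2) ∂(initLaw m p) :=
        integral_mono (integrable_sq_network_sub u c)
          ((hsq.add (integrable_const _)).const_mul 2) fun ω => by
            linarith [sq_nonneg (network ω.1 ω.2 u + c)]
    _ = 2 * (∫ ω, network ω.1 ω.2 u ^ 2 ∂(initLaw m p) + c ^ 2) := by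
        rw [integral_const_mul, integral_add hsq (integrable_const _), integral_const,
          probReal_univ, one_smul]
    _ ≤ 2 * (‖u‖ ^ 2 + c ^ 2) := by
        gcongr
        exact integral_sq_network_le u

theorem integral_norm_sq_errorVec_le (hx : ∀ i, ‖x i‖ ≤ 1) {B : ℝ} (hy : ∀ i, |y i| ≤ B) :
    ∫ ω, ‖errorVec x y ω.2 ω.1‖ ^ 2 ∂(initLaw m p) ≤ n * (2 * (1 + B ^ 2)) := by
  simp only [EuclideanSpace.real_norm_sq_eq]
  calc ∫ ω, ∑ i, (network ω.1 ω.2 (x i) - y i) ^ 2 ∂(initLaw m p)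
      = ∑ i, ∫ ω, (network ω.1 ω.2 (x i) - y i) ^ 2 ∂(initLaw m p) :=
        integral_finsetSum _ fun i _ => integrable_sq_network_sub (x i) (y i)
    _ ≤ ∑ _i : Fin n, 2 * (1 + B ^ 2) := by
        refine Finset.sum_le_sum fun i _ => (integral_sq_network_sub_le (x i) (y i)).trans ?_
        have hyB : y i ^ 2 ≤ B ^ 2 := sq_le_sq.2 ((hy i).trans (le_abs_self B))
        have hx1 : ‖x i‖ ^ 2 ≤ 1 := pow_le_one₀ (norm_nonneg _) (hx i)
        linarith
    _ = n * (2 * (1 + B ^ 2)) := by simp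

end Outputs

end Initialization

section GoodInitialization

variable {m n p : ℕ} {x : Fin n → EuclideanSpace ℝ (Fin p)} {y : Fin n → ℝ}

/-- The initializations `(W, a)` from which the heavy ball flow is shown to converge: the error is
small, few preactivations are within `R` of the kink of the ReLU, and the kernel is close to its
infinite-width limit. That the signs square to one is only almost surely true, so it is included. -/
def goodInit (m : ℕ) (x : Fin n → EuclideanSpace ℝ (Fin p)) (y : Fin n → ℝ) (R θ₁ θ₂ θ₃ : ℝ) :
    Set ((Fin m → EuclideanSpace ℝ (Fin p)) × (Fin m → ℝ)) :=
  {ω | (∀ r, ω.2 r ^ 2 = 1) ∧ ‖errorVec x y ω.2 ω.1‖ ^ 2 < θ₁ ∧ flipFraction x R ω.1 < θ₂ ∧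
    kernelDeviation x ω.1 < θ₃}

theorem measurableSet_goodInit (R θ₁ θ₂ θ₃ : ℝ) :
    MeasurableSet (goodInit m x y R θ₁ θ₂ θ₃) := by
  have hsigns : MeasurableSet
      {ω : (Fin m → EuclideanSpace ℝ (Fin p)) × (Fin m → ℝ) | ∀ r, ω.2 r ^ 2 = 1} :=
    measurableSet_setOfPred.2 (Measurable.forall fun r =>
      measurableSet_setOfPred.1 (measurableSet_eq_fun (by fun_prop) measurable_const))
  exact hsigns.inter ((measurableSet_lt (measurable_norm_sq_errorVec x y) measurable_const).inter
    ((measurableSet_lt ((measurable_flipFraction x R).comp measurable_fst) measurable_const).inter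
      (measurableSet_lt ((measurable_kernelDeviation x).comp measurable_fst) measurable_const)))

theorem compl_goodInit_subset (R θ₁ θ₂ θ₃ : ℝ) :
    (goodInit m x y R θ₁ θ₂ θ₃)ᶜ ⊆ {ω | ¬ ∀ r, ω.2 r ^ 2 = 1} ∪
      {ω | θ₁ ≤ ‖errorVec x y ω.2 ω.1‖ ^ 2} ∪ {ω | θ₂ ≤ flipFraction x R ω.1} ∪
      {ω | θ₃ ≤ kernelDeviation x ω.1} := by
  intro ω hω
  by_contra hgood
  simp only [Set.mem_union, Set.mem_ofPred_eq, not_or, not_le, not_not, and_assoc] at hgood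
  exact hω hgood

theorem one_sub_le_initLaw_real_goodInit (hm : 0 < m) (hx : ∀ i, ‖x i‖ = 1) {B : ℝ}
    (hy : ∀ i, |y i| ≤ B) {R θ₁ θ₂ θ₃ η₁ η₂ η₃ : ℝ} (hR : 0 ≤ R) (hθ₁ : 0 < θ₁) (hθ₂ : 0 < θ₂)
    (hθ₃ : 0 < θ₃) (herror : n * (2 * (1 + B ^ 2)) ≤ η₁ * θ₁) (hflip : n * R ≤ η₂ * θ₂)
    (hkernel : (n : ℝ) ^ 2 / m ≤ η₃ * θ₃) :
    1 - (η₁ + η₂ + η₃) ≤ (initLaw m p).real (goodInit m x y R θ₁ θ₂ θ₃) := by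
  have hx' (i : Fin n) : ‖x i‖ ≤ 1 := (hx i).le
  have hsigns_bad : (initLaw m p).real {ω | ¬ ∀ r, ω.2 r ^ 2 = 1} = 0 := by
    rw [measureReal_eq_zero_iff]
    exact ae_sq_eq_one_initLaw
  have herror_bad : (initLaw m p).real {ω | θ₁ ≤ ‖errorVec x y ω.2 ω.1‖ ^ 2} ≤ η₁ :=
    measureReal_ge_le_of_integral_le (fun _ => sq_nonneg _) (integrable_norm_sq_errorVec x y) hθ₁
      ((integral_norm_sq_errorVec_le hx' hy).trans herror)
  have hflip_bad : (initLaw m p).real {ω | θ₂ ≤ flipFraction x R ω.1} ≤ η₂ :=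
    measureReal_ge_le_of_integral_le (fun _ => by unfold flipFraction; positivity)
      (integrable_flipFraction x R) hθ₂ ((integral_flipFraction_le hx hR).trans hflip)
  have hkernel_bad : (initLaw m p).real {ω | θ₃ ≤ kernelDeviation x ω.1} ≤ η₃ :=
    measureReal_ge_le_of_integral_le (fun _ => by unfold kernelDeviation; positivity)
      (integrable_kernelDeviation hx') hθ₃ ((integral_kernelDeviation_le hm hx').trans hkernel)
  have hunion := (measureReal_mono (μ := initLaw m p)
      (compl_goodInit_subset (x := x) (y := y) R θ₁ θ₂ θ₃)).trans <|
    (measureReal_union_le _ _).trans <| add_le_add_left ((measureReal_union_le _ _).trans <|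
      add_le_add_left (measureReal_union_le _ _) _) _
  rw [probReal_compl_eq_one_sub (measurableSet_goodInit R θ₁ θ₂ θ₃)] at hunion
  linarith

theorem displacement_lt (hn : 0 < n) (hm : 0 < m) {ρ e R θ : ℝ} (hρ : 0 < ρ) (hR : 0 ≤ R)
    (he : e ^ 2 < θ) (hθ : 256 / 63 * ((n : ℝ) / m * θ) / ρ ^ 4 ≤ R ^ 2) :
    √n / √m * (e / √(1 - (3 / 4) ^ 2)) / (2 * ρ - ρ / 2) / (ρ / 2) < R := by
  have hn' : (0 : ℝ) < n := Nat.cast_pos.2 hn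
  have hm' : (0 : ℝ) < m := Nat.cast_pos.2 hm
  refine lt_of_pow_lt_pow_left₀ 2 hR (lt_of_lt_of_le ?_ hθ)
  calc (√n / √m * (e / √(1 - (3 / 4) ^ 2)) / (2 * ρ - ρ / 2) / (ρ / 2)) ^ 2
      = 256 / 63 * ((n : ℝ) / m * e ^ 2) / ρ ^ 4 := by
        rw [show 2 * ρ - ρ / 2 = 3 / 2 * ρ by ring]
        simp only [div_pow, mul_pow, Real.sq_sqrt hn'.le, Real.sq_sqrt hm'.le]
        rw [Real.sq_sqrt (by norm_num)]
        field_simp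
        ring
    _ < 256 / 63 * ((n : ℝ) / m * θ) / ρ ^ 4 := by gcongr

theorem mul_sum_sq_le_ntkMatrix_of_kernelDeviation_le {W : Fin m → EuclideanSpace ℝ (Fin p)}
    {lam c : ℝ} (hlam : lam ≤ lambdaMin (limitNTK x)) (hc : 0 ≤ c)
    (hW : kernelDeviation x W ≤ c ^ 2) (z : Fin n → ℝ) :
    (lam - c) * ∑ i, z i ^ 2 ≤ z ⬝ᵥ (ntkMatrix x W).mulVec z := by
  have hlimit : lam * ∑ i, z i ^ 2 ≤ z ⬝ᵥ (limitNTK x).mulVec z :=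
    (mul_le_mul_of_nonneg_right hlam (by positivity)).trans
      (lambdaMin_mul_sum_sq_le (isHermitian_limitNTK x) z)
  have hclose := dotProduct_mulVec_ge_of_sum_sq_sub_le hc hW z
  linarith

theorem mul_norm_sq_errorVec_le_pseudoLoss {W : Fin m → EuclideanSpace ℝ (Fin p)}
    {a : Fin m → ℝ} {c : ℝ}
    (hH : ∀ z : Fin n → ℝ, c * ∑ i, z i ^ 2 ≤ z ⬝ᵥ (ntkMatrix x W).mulVec z) :
    c * ‖errorVec x y a W‖ ^ 2 ≤ 2 * pseudoLoss x y W a := by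
  rw [EuclideanSpace.real_norm_sq_eq, pseudoLoss]
  exact (hH (predError x y W a)).trans_eq (by ring)

theorem loss_le_of_mem_goodInit (hn : 0 < n) (hm : 0 < m) {ρ R θ : ℝ} (hρ : 0 < ρ)
    (hx : ∀ i, ‖x i‖ ≤ 1) (hlam : 2 * ρ ^ 2 ≤ lambdaMin (limitNTK x)) (hR : 0 ≤ R)
    (hθ : 256 / 63 * ((n : ℝ) / m * θ) / ρ ^ 4 ≤ R ^ 2) {a : Fin m → ℝ}
    {W : ℝ → Fin m → EuclideanSpace ℝ (Fin p)}
    (hgood : (W 0, a) ∈ goodInit m x y R θ ((ρ / 6) ^ 2) ((2 * ρ ^ 2 / 9) ^ 2))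
    (hflow : IsHeavyBallFlow (2 * ρ) x y a W) {t : ℝ} (ht : 0 ≤ t) :
    loss x y (W t) a ≤ 2 / ρ ^ 2 * Real.exp (-(ρ * t)) * pseudoLoss x y (W 0) a := by
  obtain ⟨ha, herror, hflip, hkernel⟩ := hgood
  obtain ⟨V, hV⟩ := hflow.exists_velocity
  have hH (z : Fin n → ℝ) :
      (ρ / (3 / 4)) ^ 2 * ∑ i, z i ^ 2 ≤ z ⬝ᵥ (ntkMatrix x (W 0)).mulVec z := by
    convert mul_sum_sq_le_ntkMatrix_of_kernelDeviation_le hlam (by positivity) hkernel.le z using 2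
    ring
  have hdecay := hV.norm_sq_errorVec_le_of_displacement_lt (κ := 3 / 4) hρ (by norm_num)
    (by norm_num) hx ha hH ((Real.sqrt_le_iff.2 ⟨by positivity, hflip.le⟩).trans_eq (by ring))
    (displacement_lt hn hm hρ hR herror hθ) ht
  have hinit := mul_norm_sq_errorVec_le_pseudoLoss (y := y) (a := a) hH
  have hloss : 0 ≤ pseudoLoss x y (W 0) a := by
    have : 0 ≤ (ρ / (3 / 4)) ^ 2 * ‖errorVec x y a (W 0)‖ ^ 2 := by positivity
    linarith
  calc loss x y (W t) a
      = 1 / 2 * ‖errorVec x y a (W t)‖ ^ 2 := loss_eq_norm_sq_errorVec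
    _ ≤ 8 / 7 * (Real.exp (-(ρ * t)) * ‖errorVec x y a (W 0)‖ ^ 2) := by linarith
    _ = 9 / 14 / ρ ^ 2 * Real.exp (-(ρ * t)) *
          ((ρ / (3 / 4)) ^ 2 * ‖errorVec x y a (W 0)‖ ^ 2) := by field_simp; ring
    _ ≤ 9 / 14 / ρ ^ 2 * Real.exp (-(ρ * t)) * (2 * pseudoLoss x y (W 0) a) := by gcongr
    _ = 9 / 7 * (1 / ρ ^ 2 * Real.exp (-(ρ * t)) * pseudoLoss x y (W 0) a) := by ring
    _ ≤ 2 * (1 / ρ ^ 2 * Real.exp (-(ρ * t)) * pseudoLoss x y (W 0) a) := by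
        gcongr
        norm_num
    _ = 2 / ρ ^ 2 * Real.exp (-(ρ * t)) * pseudoLoss x y (W 0) a := by ring

end GoodInitialization

section Width

variable {B n m δ lam : ℝ}

theorem sq_div_width_le (hn : 1 ≤ n) (hm : 0 < m) (hδ : 0 < δ) (hδ1 : δ ≤ 1) (hlam : 0 < lam)
    (hlam1 : lam ≤ 1) (hwidth : 10 ^ 7 * (1 + B ^ 2) * (n ^ 4 / (δ ^ 3 * lam ^ 4)) ≤ m) :
    n ^ 2 / m ≤ δ / 3 * (lam / 9) ^ 2 := by
  have hmul : 10 ^ 7 * (1 + B ^ 2) * n ^ 4 ≤ m * (δ ^ 3 * lam ^ 4) := by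
    rwa [← mul_div_assoc, div_le_iff₀ (by positivity)] at hwidth
  have hB : (0 : ℝ) ≤ B ^ 2 * n ^ 4 := by positivity
  have hpow : n ^ 2 ≤ n ^ 4 := pow_le_pow_right₀ hn (by norm_num)
  have hδlam : m * (δ ^ 3 * lam ^ 4) ≤ m * (δ * lam ^ 2) := by
    gcongr m * (?_ * ?_)
    · exact pow_le_of_le_one hδ.le hδ1 (by norm_num)
    · exact pow_le_pow_of_le_one hlam.le hlam1 (by norm_num)
  rw [div_le_iff₀ hm]
  linarith [pow_nonneg (zero_le_one.trans hn) 4]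

theorem sq_displacement_le (hn : 0 < n) (hm : 0 < m) (hδ : 0 < δ) (hlam : 0 < lam)
    (hwidth : 10 ^ 7 * (1 + B ^ 2) * (n ^ 4 / (δ ^ 3 * lam ^ 4)) ≤ m) :
    256 / 63 * (n / m * (6 * n * (1 + B ^ 2) / δ)) / (lam / 2) ^ 2 ≤
      (lam * δ / (216 * n)) ^ 2 := by
  have hmul : 10 ^ 7 * ((1 + B ^ 2) * n ^ 4) ≤ m * (δ ^ 3 * lam ^ 4) := by
    rwa [← mul_div_assoc, div_le_iff₀ (by positivity), mul_assoc] at hwidth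
  calc 256 / 63 * (n / m * (6 * n * (1 + B ^ 2) / δ)) / (lam / 2) ^ 2
      = 2048 / 21 * ((1 + B ^ 2) * n ^ 4) / (m * δ * lam ^ 2 * n ^ 2) := by field_simp; ring
    _ ≤ m * (δ ^ 3 * lam ^ 4) / 46656 / (m * δ * lam ^ 2 * n ^ 2) := by
        have hpos : 0 ≤ (1 + B ^ 2) * n ^ 4 := by positivity
        gcongr
        linarith
    _ = (lam * δ / (216 * n)) ^ 2 := by field_simp; ring

end Width

theorem ofReal_one_sub_le_initLaw_goodInit {m n p : ℕ} {x : Fin n → EuclideanSpace ℝ (Fin p)}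
    {y : Fin n → ℝ} {B ρ δ : ℝ} (hn : 0 < n) (hm : 0 < m) (hx : ∀ i, ‖x i‖ = 1)
    (hy : ∀ i, |y i| ≤ B) (hρ : 0 < ρ) (hlam : 2 * ρ ^ 2 ≤ lambdaMin (limitNTK x)) (hδ : 0 < δ)
    (hδ1 : δ ≤ 1)
    (hwidth : 10 ^ 7 * (1 + B ^ 2) * ((n : ℝ) ^ 4 / (δ ^ 3 * (2 * ρ ^ 2) ^ 4)) ≤ m) :
    ENNReal.ofReal (1 - δ) ≤ initLaw m p (goodInit m x y (2 * ρ ^ 2 * δ / (216 * n))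
      (6 * n * (1 + B ^ 2) / δ) ((ρ / 6) ^ 2) ((2 * ρ ^ 2 / 9) ^ 2)) := by
  have hlam1 : 2 * ρ ^ 2 ≤ 1 := hlam.trans (lambdaMin_limitNTK_le_one hn fun i => (hx i).le)
  have herror : n * (2 * (1 + B ^ 2)) ≤ δ / 3 * (6 * n * (1 + B ^ 2) / δ) := by
    field_simp
    norm_num
  have hflip : n * (2 * ρ ^ 2 * δ / (216 * n)) ≤ δ / 3 * (ρ / 6) ^ 2 := by
    field_simp
    norm_num
  have hkernel : (n : ℝ) ^ 2 / m ≤ δ / 3 * (2 * ρ ^ 2 / 9) ^ 2 :=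
    sq_div_width_le (by exact_mod_cast hn) (by exact_mod_cast hm) hδ hδ1 (by positivity) hlam1
      hwidth
  rw [ENNReal.ofReal_le_iff_le_toReal (measure_ne_top _ _)]
  exact (by linarith : 1 - δ ≤ 1 - (δ / 3 + δ / 3 + δ / 3)).trans
    (one_sub_le_initLaw_real_goodInit hm hx hy (by positivity) (by positivity) (by positivity)
      (by positivity) herror hflip hkernel)

end HeavyBallNTK

open HeavyBallNTK in
theorem mainTheorem1_general (B : ℝ) :
    ∃ C : ℝ, 0 < C ∧
      ∀ (n p m : ℕ) (x : Fin n → EuclideanSpace ℝ (Fin p)) (y : Fin n → ℝ) (lam0 δ : ℝ),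
        0 < n →
        (∀ i, ‖x i‖ = 1) →
        (∀ i, |y i| ≤ B) →
        lam0 ≤ lambdaMin (limitNTK x) →
        0 < lam0 →
        0 < δ → δ ≤ 1 →
        C * ((n : ℝ) ^ 4 / (δ ^ 3 * lam0 ^ 4)) ≤ (m : ℝ) →
        ∃ G : Set ((Fin m → EuclideanSpace ℝ (Fin p)) × (Fin m → ℝ)),
          MeasurableSet G ∧
          ENNReal.ofReal (1 - δ) ≤ initLaw m p G ∧
          ∀ (W₀ : Fin m → EuclideanSpace ℝ (Fin p)) (a : Fin m → ℝ), (W₀, a) ∈ G →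
            ∀ W : ℝ → Fin m → EuclideanSpace ℝ (Fin p),
              W 0 = W₀ →
              IsHeavyBallFlow (√(2 * lam0)) x y a W →
              ∀ t : ℝ, 0 ≤ t →
                loss x y (W t) a ≤
                  4 / lam0 * Real.exp (-(√(lam0 / 2) * t)) * pseudoLoss x y W₀ a := by
  refine ⟨10 ^ 7 * (1 + B ^ 2), by positivity, ?_⟩
  intro n p m x y lam0 δ hn hx hy hlam hlam0 hδ hδ1 hwidth
  have hm : (0 : ℝ) < m := lt_of_lt_of_le (by positivity) hwidth
  obtain ⟨ρ, hρ, rfl⟩ : ∃ ρ, 0 < ρ ∧ lam0 = 2 * ρ ^ 2 :=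
    ⟨√(lam0 / 2), by positivity, by rw [Real.sq_sqrt (by positivity)]; ring⟩
  have hrate : √(2 * ρ ^ 2 / 2) = ρ := by
    rw [mul_div_cancel_left₀ _ two_ne_zero, Real.sqrt_sq hρ.le]
  have hdamping : √(2 * (2 * ρ ^ 2)) = 2 * ρ := by
    rw [show 2 * (2 * ρ ^ 2) = (2 * ρ) ^ 2 by ring, Real.sqrt_sq (by positivity)]
  refine ⟨_, measurableSet_goodInit _ _ _ _, ofReal_one_sub_le_initLaw_goodInit hn
    (Nat.cast_pos.1 hm) hx hy hρ hlam hδ hδ1 hwidth, ?_⟩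
  rintro _ a hgood W rfl hflow t ht
  rw [hdamping] at hflow
  rw [hrate, show 4 / (2 * ρ ^ 2) = 2 / ρ ^ 2 by ring]
  have hdisp := sq_displacement_le (Nat.cast_pos.2 hn) hm hδ hlam0 hwidth
  rw [mul_div_cancel_left₀ _ two_ne_zero, ← pow_mul] at hdisp
  exact loss_le_of_mem_goodInit hn (Nat.cast_pos.1 hm) hρ (fun i => (hx i).le) hlam
    (by positivity) hdisp hgood hflow ht

theorem mainTheorem1 (B : ℝ) :
    ∃ C : ℝ, 0 < C ∧
      ∀ (n p m : ℕ) (x : Fin n → EuclideanSpace ℝ (Fin p)) (y : Fin n → ℝ) (lam0 δ : ℝ),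
        0 < n →
        (∀ i, ‖x i‖ = 1) →
        (∀ i, |y i| < B) →
        lam0 = HeavyBallNTK.lambdaMin (HeavyBallNTK.limitNTK x) →
        0 < lam0 →
        0 < δ → δ < 1 →
        C * ((n : ℝ) ^ 6 / (δ ^ 3 * lam0 ^ 4)) ≤ (m : ℝ) →
        ∃ G : Set ((Fin m → EuclideanSpace ℝ (Fin p)) × (Fin m → ℝ)),
          MeasurableSet G ∧
          ENNReal.ofReal (1 - δ) ≤ HeavyBallNTK.initLaw m p G ∧
          ∀ (W₀ : Fin m → EuclideanSpace ℝ (Fin p)) (a : Fin m → ℝ), (W₀, a) ∈ G →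
            ∀ W : ℝ → Fin m → EuclideanSpace ℝ (Fin p),
              W 0 = W₀ →
              HeavyBallNTK.IsHeavyBallFlow (Real.sqrt (2 * lam0)) x y a W →
              ∀ t : ℝ, 0 ≤ t →
                HeavyBallNTK.loss x y (W t) a ≤
                  4 / lam0 * Real.exp (-(Real.sqrt (lam0 / 2) * t)) *
                    HeavyBallNTK.pseudoLoss x y W₀ a := by
  obtain ⟨C, hC, hgeneral⟩ := mainTheorem1_general B
  refine ⟨C, hC, fun n p m x y lam0 δ hn hx hy hlam hlam0 hδ hδ1 hwidth => ?_⟩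
  refine hgeneral n p m x y lam0 δ hn hx (fun i => (hy i).le) hlam.le hlam0 hδ hδ1.le
    (le_trans ?_ hwidth)
  have : (1 : ℝ) ≤ n := Nat.one_le_cast.2 hn
  gcongr
  norm_num
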